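/- **Setting.** A *sublinear expectation space* $(\Omega,\mathcal H,\hat{\mathbb E})$ consists of a nonempty set $\Omega$, a vector lattice $\mathcal H$ of real-valued functions on $\Omega$ that contains the constants and satisfies $\varphi(X_1,\dots,X_n)\in\mathcal H$ for all $X_1,\dots,X_n\in\mathcal H$ and all Lipschitz $\varphi:\mathbb R^n\to\mathbb R$, and a functional $\hat{\mathbb E}:\mathcal H\to\mathbb R$ that is monotone, sub-additive, positively homogeneous and satisfies $\hat{\mathbb E}[c]=c$ for constants $c$. Let $\Theta$ be the set of all linear, monotone, constant-preserving functionals $\mathbb E:\mathcal H\to\mathbb R$ with $\mathbb E[X]\le\hat{\mathbb E}[X]$ for all $X\in\mathcal H$, and for $X=(X^1,\dots,X^d)\in\mathcal H^d$ write $\mathbb E[X]=(\mathbb E[X^1],\dots,\mathbb E[X^d])$. For a function $f\ge 0$ on $\Omega$ put $\hat{\mathbb E}[f]=\sup\{\hat{\mathbb E}[Y]:Y\in\mathcal H,\ Y\le f\}$, which is the given value if $f\in\mathcal H$. $C_{lip}(\mathbb R^k)$ is the set of Lipschitz functions on $\mathbb R^k$ with its Euclidean norm $|\cdot|$, and $l_\phi$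 denotes a Lipschitz constant of $\phi$. Let $\mathbb T$ be $\mathbb R_+=[0,\infty)$, $\{0,1,2,\dots\}$ or $\{1,2,\dots\}$, and let $X_t\in\mathcal H^d$ for $t\in\mathbb T$. The family $(X_t)_{t\in\mathbb T}$ is *identical* if $\hat{\mathbb E}[\phi(X_s)]=\hat{\mathbb E}[\phi(X_t)]$ for all $s,t\in\mathbb T$ and $\phi\in C_{lip}(\mathbb R^d)$. It is *$\alpha$-mixing with constant $c_X$* (where $\alpha,c_X>0$) if for all non-empty finite $\Lambda^1,\Lambda^2\subset\mathbb T$ with $\max\Lambda^1\le\min\Lambda^2$ and all $\phi\in C_{lip}(\mathbb R^{2d})$, $$\Big|\hat{\mathbb E}\big[\phi(\bar X_{\Lambda^1},\bar X_{\Lambda^2})\big]-\hat{\mathbb E}\Big[\hat{\mathbb E}\big[\phi(x,\bar X_{\Lambda^2})\big]\big|_{x=\bar X_{\Lambda^1}}\Big]\Big|\le c_X\,l_\phi\,e^{-\alpha|\min\Lambda^2-\max\Lambda^1|},\qquad \bar X_{\Lambda}=\frac1{|\Lambda|}\sum_{u\in\Lambda}X_u .$$ A sequence $(t_k)_{k\ge1}$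 in $\mathbb R_+$ is *$(\gamma,\delta)$-admissible with constants $c_1,c_2,N_0>0$* if for every integer $n\ge N_0$ with $n \geq 1$ there is $\Pi_n\subset\{1,\dots,n\}$ with $|\Pi_n|\le c_1n^\gamma$ and $|t_i-t_j|\ge c_2(\ln n)^{1+\delta}$ for all distinct $i,j\in\{1,\dots,n\}\setminus\Pi_n$. **Theorem.** (1) Let $\alpha,\delta,c_X,c_1,c_2,N_0>0$ and $0<\gamma<1$. There is a constant $C>0$, depending only on these numbers, such that the following holds. Let $(X_t)_{t\in\mathbb T}$, with $\mathbb T=\mathbb R_+$ or $\mathbb T=\{0,1,2,\dots\}$, be a $d$-dimensional identical family on a sublinear expectation space $(\Omega,\mathcal H,\hat{\mathbb E})$ that is $\alpha$-mixing with constant $c_X$, with $\hat{\mathbb E}[|X_0|^2]<\infty$. Let $(t_k)_{k\ge1}$ be a sequence in $\mathbb T$ that is $(\gamma,\delta)$-admissible with constants $c_1,c_2,N_0$. Put $S_n=\frac1n\sum_{k=1}^nX_{t_k}$ and $\Gamma=\{\mathbb E[X_0]:\mathbb E\in\Theta\}$. Then for every $\phi\in C_{lip}(\mathbb R^d)$ the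 maximum of $\phi$ on $\Gamma$ is attained, and for all integers $n\ge1$ $$\Big|\hat{\mathbb E}[\phi(S_n)]-\max_{x\in\Gamma}\phi(x)\Big|\le C\big(1+\hat{\mathbb E}[|X_0|^2]\big)\,l_\phi\,\big(n^{-1/2}+n^{-(1-\gamma)}\big).$$ If moreover $\gamma\le 1/2$, the left-hand side is at most $C(1+\hat{\mathbb E}[|X_0|^2])\,l_\phi\,n^{-1/2}$. (2) Let $(X_k)_{k\ge1}$ be a $d$-dimensional identical sequence on a sublinear expectation space that is $\alpha$-mixing with some constant $c_X$ for some $\alpha>0$, with $\hat{\mathbb E}[|X_1|^2]<\infty$. Let $P$ be a real polynomial of degree $m\ge2$ with positive leading coefficient, $t_k=\lfloor P(k)\rfloor\vee1$ for $k\ge1$, and $\Gamma=\{\mathbb E[X_1]:\mathbb E\in\Theta\}$. Then there is $C>0$ such that for every $\phi\in C_{lip}(\mathbb R^d)$ the maximum of $\phi$ on $\Gamma$ is attained, and for all integers $n\ge1$ $$\Big|\hat{\mathbb E}\Big[\phi\Big(\frac1n\sum_{k=1}^nX_{t_k}\Big)\Big]-\max_{x\in\Gamma}\phi(x)\Big|\le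 C\,l_\phi\,n^{-1/2}.$$ -/

import Mathlib

open scoped NNReal

/-- A sublinear expectation space `(Ω, H, E)`: `H` is a vector lattice of real functions on `Ω`
containing the constants and stable under Lipschitz functions of finitely many of its elements, and
`E : H → ℝ` is monotone, constant preserving, sub-additive and positively homogeneous. -/
structure SublinearExpectationSpace (Ω : Type*) where
  H : Submodule ℝ (Ω → ℝ)
  const_mem : ∀ c : ℝ, (fun _ => c) ∈ H
  abs_mem : ∀ X ∈ H, (fun ω => |X ω|) ∈ H
  lip_mem : ∀ (n : ℕ) (X : Fin n → H) (φ : EuclideanSpace ℝ (Fin n) → ℝ),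
    (∃ K : ℝ≥0, LipschitzWith K φ) →
      (fun ω => φ (WithLp.toLp 2 fun i => (X i : Ω → ℝ) ω)) ∈ H
  E : H → ℝ
  mono : ∀ X Y : H, (∀ ω, (X : Ω → ℝ) ω ≤ (Y : Ω → ℝ) ω) → E X ≤ E Y
  const : ∀ c : ℝ, E ⟨fun _ => c, const_mem c⟩ = c
  subadd : ∀ X Y : H, E (X + Y) ≤ E X + E Y
  pos_hom : ∀ (r : ℝ) (X : H), 0 ≤ r → E (r • X) = r * E X

namespace SublinearExpectationSpace

variable {Ω : Type*} (S : SublinearExpectationSpace Ω)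

/-- The set `Θ` of linear expectations on `H` (linear, monotone, constant preserving) that are
dominated by `E`. -/
def Theta : Set (S.H →ₗ[ℝ] ℝ) :=
  {L | (∀ X Y : S.H, (∀ ω, (X : Ω → ℝ) ω ≤ (Y : Ω → ℝ) ω) → L X ≤ L Y) ∧
    (∀ c : ℝ, L ⟨fun _ => c, S.const_mem c⟩ = c) ∧ ∀ X : S.H, L X ≤ S.E X}

/-- The set `{L[X] : L ∈ Θ} ⊆ ℝᵈ` of the means of a random vector `X ∈ Hᵈ`. -/
def meanSet {d : ℕ} (X : Fin d → S.H) : Set (EuclideanSpace ℝ (Fin d)) :=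
  {x | ∃ L ∈ S.Theta, ∀ i, x i = L (X i)}

/-- The value at `ω` of a random vector `X ∈ Hᵈ`, as a point of Euclidean space. -/
def val {d : ℕ} (X : Fin d → S.H) (ω : Ω) : EuclideanSpace ℝ (Fin d) :=
  WithLp.toLp 2 fun i => (X i : Ω → ℝ) ω

/-- `φ(X)` for `X ∈ Hᵈ` and a Lipschitz function `φ`, as an element of `H`. -/
def comp {d : ℕ} (X : Fin d → S.H) (φ : EuclideanSpace ℝ (Fin d) → ℝ)
    (hφ : ∃ K : ℝ≥0, LipschitzWith K φ) : S.H :=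
  ⟨fun ω => φ (S.val X ω), S.lip_mem d X φ hφ⟩

theorem pair_mem {d e : ℕ} (X : Fin d → S.H) (Y : Fin e → S.H)
    (φ : WithLp 2 (EuclideanSpace ℝ (Fin d) × EuclideanSpace ℝ (Fin e)) → ℝ)
    (hφ : ∃ K : ℝ≥0, LipschitzWith K φ) :
    (fun ω => φ (WithLp.toLp 2 (S.val X ω, S.val Y ω))) ∈ S.H := by
  obtain ⟨K, hK⟩ := hφ
  have hL : LipschitzWith K fun z : EuclideanSpace ℝ (Fin (d + e)) =>
      φ (WithLp.toLp 2 (WithLp.toLp 2 fun i => z (Fin.castAdd e i),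
        WithLp.toLp 2 fun i => z (Fin.natAdd d i))) := by
    refine LipschitzWith.of_dist_le_mul fun z z' => (hK.dist_le_mul _ _).trans (le_of_eq ?_)
    rw [WithLp.prod_dist_eq_of_L2, EuclideanSpace.dist_eq, EuclideanSpace.dist_eq,
      EuclideanSpace.dist_eq, Real.sq_sqrt (by positivity), Real.sq_sqrt (by positivity),
      Fin.sum_univ_add]
    rfl
  have h := S.lip_mem (d + e) (Fin.append X Y) _ ⟨K, hL⟩
  simpa only [val, Fin.append_left, Fin.append_right] using h

/-- `φ(X, Y)` for random vectors `X`, `Y` and a Lipschitz function `φ`, as an element of `H`. -/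
def comp₂ {d e : ℕ} (X : Fin d → S.H) (Y : Fin e → S.H)
    (φ : WithLp 2 (EuclideanSpace ℝ (Fin d) × EuclideanSpace ℝ (Fin e)) → ℝ)
    (hφ : ∃ K : ℝ≥0, LipschitzWith K φ) : S.H :=
  ⟨fun ω => φ (WithLp.toLp 2 (S.val X ω, S.val Y ω)), S.pair_mem X Y φ hφ⟩

theorem E_le_add (f g : S.H) (c : ℝ) (h : ∀ ω, (f : Ω → ℝ) ω ≤ (g : Ω → ℝ) ω + c) :
    S.E f ≤ S.E g + c := by
  have h1 : S.E f ≤ S.E (g + ⟨fun _ => c, S.const_mem c⟩) := S.mono _ _ h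
  have h2 := S.subadd g ⟨fun _ => c, S.const_mem c⟩
  rw [S.const c] at h2
  exact h1.trans h2

theorem lip_snd {d e : ℕ}
    {φ : WithLp 2 (EuclideanSpace ℝ (Fin d) × EuclideanSpace ℝ (Fin e)) → ℝ}
    (hφ : ∃ K : ℝ≥0, LipschitzWith K φ) (x : EuclideanSpace ℝ (Fin d)) :
    ∃ K : ℝ≥0, LipschitzWith K fun y => φ (WithLp.toLp 2 (x, y)) := by
  obtain ⟨K, hK⟩ := hφ
  refine ⟨K, LipschitzWith.of_dist_le_mul fun y y' => ?_⟩
  refine (hK.dist_le_mul _ _).trans (le_of_eq ?_)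
  simp [WithLp.prod_dist_eq_of_L2, Real.sqrt_sq dist_nonneg]

/-- The function `x ↦ E[φ(x, Y)]`. -/
def frozen {d e : ℕ} (Y : Fin e → S.H)
    (φ : WithLp 2 (EuclideanSpace ℝ (Fin d) × EuclideanSpace ℝ (Fin e)) → ℝ)
    (hφ : ∃ K : ℝ≥0, LipschitzWith K φ) (x : EuclideanSpace ℝ (Fin d)) : ℝ :=
  S.E (S.comp Y (fun y => φ (WithLp.toLp 2 (x, y))) (lip_snd hφ x))

theorem lip_frozen {d e : ℕ} (Y : Fin e → S.H)
    (φ : WithLp 2 (EuclideanSpace ℝ (Fin d) × EuclideanSpace ℝ (Fin e)) → ℝ)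
    (hφ : ∃ K : ℝ≥0, LipschitzWith K φ) :
    ∃ K : ℝ≥0, LipschitzWith K (S.frozen Y φ hφ) := by
  obtain ⟨K, hK⟩ := id hφ
  refine ⟨K, LipschitzWith.of_le_add_mul K fun x x' => S.E_le_add _ _ _ fun ω => ?_⟩
  have h := hK.le_add_mul (WithLp.toLp 2 (x, S.val Y ω)) (WithLp.toLp 2 (x', S.val Y ω))
  have hd : dist (WithLp.toLp 2 (x, S.val Y ω)) (WithLp.toLp 2 (x', S.val Y ω)) = dist x x' := by
    simp [WithLp.prod_dist_eq_of_L2, Real.sqrt_sq dist_nonneg]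
  rw [hd] at h
  exact h

/-- `X` and `Y` are identically distributed. -/
def IdentDistrib {d : ℕ} (X Y : Fin d → S.H) : Prop :=
  ∀ (φ : EuclideanSpace ℝ (Fin d) → ℝ) (hφ : ∃ K : ℝ≥0, LipschitzWith K φ),
    S.E (S.comp X φ hφ) = S.E (S.comp Y φ hφ)

/-- A process (or sequence) whose members are all identically distributed. -/
def IsIdentical {ι : Type*} {d : ℕ} (X : ι → Fin d → S.H) : Prop :=
  ∀ s t, S.IdentDistrib (X s) (X t)

/-- The average of `X u` over `u ∈ Λ`. -/
noncomputable def avg {ι : Type*} {d : ℕ} (X : ι → Fin d → S.H) (Λ : Finset ι) : Fin d → S.H :=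
  (Λ.card : ℝ)⁻¹ • ∑ u ∈ Λ, X u

/-- The `α`-mixing inequality with constant `c` for a process `X` indexed by `ι`, where `time u` is
the real time that belongs to the index `u` (the inclusion of `ℝ≥0`, `ℕ` or `ℕ+` into `ℝ`). -/
def IsMixingWith {ι : Type*} (time : ι → ℝ) {d : ℕ} (X : ι → Fin d → S.H) (c α : ℝ) : Prop :=
  ∀ (Λ₁ Λ₂ : Finset ι) (h₁ : Λ₁.Nonempty) (h₂ : Λ₂.Nonempty),
    Λ₁.sup' h₁ time ≤ Λ₂.inf' h₂ time →
    ∀ (φ : WithLp 2 (EuclideanSpace ℝ (Fin d) × EuclideanSpace ℝ (Fin d)) → ℝ) (l : ℝ≥0)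
      (hφ : LipschitzWith l φ),
      |S.E (S.comp₂ (S.avg X Λ₁) (S.avg X Λ₂) φ ⟨l, hφ⟩) -
          S.E (S.comp (S.avg X Λ₁) (S.frozen (S.avg X Λ₂) φ ⟨l, hφ⟩)
            (S.lip_frozen (S.avg X Λ₂) φ ⟨l, hφ⟩))| ≤
        c * l * Real.exp (-α * |Λ₂.inf' h₂ time - Λ₁.sup' h₁ time|)

/-- The values `E[Y]` of the `Y ∈ H` with `Y ≤ f`. -/
def lowerValues (f : Ω → ℝ) : Set ℝ :=
  {r | ∃ Y : S.H, (∀ ω, (Y : Ω → ℝ) ω ≤ f ω) ∧ S.E Y = r}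

/-- `E[f] < ∞`, for a function `f` bounded below that need not belong to `H`. -/
def HasFiniteExpect (f : Ω → ℝ) : Prop := BddAbove (S.lowerValues f)

/-- `E[f] = sup {E[Y] : Y ∈ H, Y ≤ f}`, for a function `f` bounded below that need not belong to `H`.
It is the given `E[f]` if `f ∈ H`. -/
noncomputable def expect (f : Ω → ℝ) : ℝ := sSup (S.lowerValues f)

theorem isGreatest_lowerValues (f : S.H) : IsGreatest (S.lowerValues f) (S.E f) :=
  ⟨⟨f, fun _ => le_rfl, rfl⟩, by rintro _ ⟨Y, hY, rfl⟩; exact S.mono _ _ hY⟩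

theorem hasFiniteExpect_of_mem (f : S.H) : S.HasFiniteExpect f :=
  (S.isGreatest_lowerValues f).bddAbove

theorem expect_of_mem (f : S.H) : S.expect f = S.E f :=
  (S.isGreatest_lowerValues f).csSup_eq

/-- The sample mean `(X (t 1) + ⋯ + X (t n)) / n` along the sampling times `t`. -/
noncomputable def sampleMean {ι : Type*} {d : ℕ} (X : ι → Fin d → S.H) (t : ℕ → ι) (n : ℕ) :
    Fin d → S.H :=
  (n : ℝ)⁻¹ • ∑ k ∈ Finset.Icc 1 n, X (t k)

end SublinearExpectationSpace

/-- `(γ, δ)`-admissibility of `t 1, t 2, …`, with constants `c₁`, `c₂`, `N₀`. -/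
def IsAdmissibleWith (γ δ c₁ c₂ N₀ : ℝ) (t : ℕ → ℝ) : Prop :=
  ∀ n : ℕ, N₀ ≤ n → ∃ P ⊆ Finset.Icc 1 n, (P.card : ℝ) ≤ c₁ * (n : ℝ) ^ γ ∧
    ∀ i ∈ Finset.Icc 1 n \ P, ∀ j ∈ Finset.Icc 1 n \ P, i ≠ j →
      c₂ * Real.log n ^ (1 + δ) ≤ |t i - t j|

namespace SublinearExpectationSpace

variable {Ω : Type*} (S : SublinearExpectationSpace Ω)

theorem E_zero : S.E 0 = 0 := S.const 0

theorem E_const (c : ℝ) (f : S.H) (h : ∀ ω, (f : Ω → ℝ) ω = c) : S.E f = c := by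
  have : f = ⟨fun _ => c, S.const_mem c⟩ := Subtype.ext (funext h)
  rw [this, S.const]

theorem E_le_add_add (f g h : S.H) (c : ℝ)
    (H : ∀ ω, (f : Ω → ℝ) ω ≤ (g : Ω → ℝ) ω + (h : Ω → ℝ) ω + c) :
    S.E f ≤ S.E g + S.E h + c :=
  (S.E_le_add f (g + h) c H).trans (by linarith [S.subadd g h])

theorem E_congr (f g : S.H) (h : ∀ ω, (f : Ω → ℝ) ω = (g : Ω → ℝ) ω) : S.E f = S.E g :=
  congrArg S.E (Subtype.ext (funext h))

theorem E_sum_le {ι : Type*} (s : Finset ι) (f : ι → S.H) :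
    S.E (∑ i ∈ s, f i) ≤ ∑ i ∈ s, S.E (f i) := by
  classical
  induction s using Finset.induction_on with
  | empty => simp [S.E_zero]
  | insert a s ha ih =>
    rw [Finset.sum_insert ha, Finset.sum_insert ha]
    linarith [S.subadd (f a) (∑ i ∈ s, f i)]

/-- A linear functional on `V` dominated by `E ∘ A` factors through a member of `Θ`. -/
theorem exists_mem_Theta_of_le {V : Type*} [AddCommGroup V] [Module ℝ V] (A : V →ₗ[ℝ] S.H)
    (f : V →ₗ[ℝ] ℝ) (h : ∀ v, f v ≤ S.E (A v)) : ∃ L ∈ S.Theta, ∀ v, L (A v) = f v := by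
  have hker : LinearMap.ker A ≤ LinearMap.ker f := by
    intro v hv
    rw [LinearMap.mem_ker] at hv ⊢
    have h1 := h v
    have h2 := h (-v)
    rw [map_neg, map_neg, hv, neg_zero, S.E_zero] at h2
    rw [hv, S.E_zero] at h1
    linarith
  let p : S.H →ₗ.[ℝ] ℝ :=
    ⟨LinearMap.range A, ((LinearMap.ker A).liftQ f hker).comp A.quotKerEquivRange.symm.toLinearMap⟩
  have hp : ∀ v, p ⟨A v, LinearMap.mem_range_self A v⟩ = f v := by
    intro v
    change ((LinearMap.ker A).liftQ f hker)
      (A.quotKerEquivRange.symm ⟨A v, LinearMap.mem_range_self A v⟩) = f v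
    rw [LinearMap.quotKerEquivRange_symm_apply_image]
    simp
  obtain ⟨L, hL, hLE⟩ := exists_extension_of_le_sublinear p S.E
    (fun r hr X => S.pos_hom r X hr.le) S.subadd (by
      rintro ⟨_, v, rfl⟩
      rw [hp]
      exact h v)
  refine ⟨L, ⟨fun X Y hXY => ?_, fun c => ?_, hLE⟩, fun v => ?_⟩
  · have h1 : S.E (X - Y) ≤ S.E 0 := S.mono _ _ fun ω => sub_nonpos.2 (hXY ω)
    have h2 := hLE (X - Y)
    rw [map_sub] at h2
    rw [S.E_zero] at h1
    linarith
  · have h1 := hLE ⟨fun _ => c, S.const_mem c⟩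
    have h2 := hLE (-⟨fun _ => c, S.const_mem c⟩)
    rw [S.const] at h1
    rw [map_neg, S.E_const (-c) _ fun ω => rfl] at h2
    linarith
  · rw [← hp v]
    exact hL ⟨A v, LinearMap.mem_range_self A v⟩

theorem exists_mem_Theta_eq (Z : S.H) : ∃ L ∈ S.Theta, L Z = S.E Z := by
  obtain ⟨L, hL, h⟩ := S.exists_mem_Theta_of_le (LinearMap.toSpanSingleton ℝ S.H Z)
    (LinearMap.toSpanSingleton ℝ ℝ (S.E Z)) (fun r => by
      simp only [LinearMap.toSpanSingleton_apply, smul_eq_mul]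
      rcases le_total 0 r with hr | hr
      · exact (S.pos_hom r Z hr).ge
      · have h1 := S.pos_hom (-r) Z (by linarith)
        have h2 := S.subadd (r • Z) (-r • Z)
        rw [← add_smul, add_neg_cancel, zero_smul, S.E_zero, h1] at h2
        linarith)
  exact ⟨L, hL, by simpa using h 1⟩

section vectors

variable {d : ℕ}

theorem val_add (X Y : Fin d → S.H) (ω : Ω) : S.val (X + Y) ω = S.val X ω + S.val Y ω := rfl

theorem val_smul (a : ℝ) (X : Fin d → S.H) (ω : Ω) : S.val (a • X) ω = a • S.val X ω := rfl

theorem val_zero (ω : Ω) : S.val (0 : Fin d → S.H) ω = 0 := rfl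

theorem val_sum {ι : Type*} (s : Finset ι) (X : ι → Fin d → S.H) (ω : Ω) :
    S.val (∑ i ∈ s, X i) ω = ∑ i ∈ s, S.val (X i) ω := by
  classical
  induction s using Finset.induction_on with
  | empty => rfl
  | insert a s ha ih => rw [Finset.sum_insert ha, Finset.sum_insert ha, val_add, ih]

/-- The linear combination `⟨v, X⟩` of the components of a random vector. -/
noncomputable def lin (X : Fin d → S.H) (v : EuclideanSpace ℝ (Fin d)) : S.H := ∑ i, v i • X i

theorem lin_apply (X : Fin d → S.H) (v : EuclideanSpace ℝ (Fin d)) (ω : Ω) :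
    (S.lin X v : Ω → ℝ) ω = inner ℝ v (S.val X ω) := by
  simp [lin, val, PiLp.inner_apply, mul_comm]

theorem map_lin (X : Fin d → S.H) (L : S.H →ₗ[ℝ] ℝ) (x : EuclideanSpace ℝ (Fin d))
    (h : ∀ i, x i = L (X i)) (v : EuclideanSpace ℝ (Fin d)) : L (S.lin X v) = inner ℝ v x := by
  simp [lin, PiLp.inner_apply, h, mul_comm]

theorem mem_meanSet_iff (X : Fin d → S.H) (x : EuclideanSpace ℝ (Fin d)) :
    x ∈ S.meanSet X ↔ ∀ v, inner ℝ v x ≤ S.E (S.lin X v) := by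
  constructor
  · rintro ⟨L, hL, h⟩ v
    rw [← S.map_lin X L x h v]
    exact hL.2.2 _
  · intro h
    obtain ⟨L, hL, hLA⟩ := S.exists_mem_Theta_of_le (Fintype.linearCombination ℝ X)
      (Fintype.linearCombination ℝ (fun i => x i)) (fun v => by
        have := h (WithLp.toLp 2 v)
        simpa [lin, PiLp.inner_apply, Fintype.linearCombination_apply, mul_comm] using this)
    refine ⟨L, hL, fun i => ?_⟩
    have := hLA (Pi.single i 1)
    simpa using this.symm

theorem exists_mem_meanSet_inner_eq (X : Fin d → S.H) (v : EuclideanSpace ℝ (Fin d)) :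
    ∃ y ∈ S.meanSet X, S.E (S.lin X v) = inner ℝ v y := by
  obtain ⟨L, hL, h⟩ := S.exists_mem_Theta_eq (S.lin X v)
  refine ⟨WithLp.toLp 2 fun i => L (X i), ⟨L, hL, fun i => rfl⟩, ?_⟩
  rw [← h]
  exact S.map_lin X L _ (fun i => rfl) v

theorem convex_meanSet (X : Fin d → S.H) : Convex ℝ (S.meanSet X) := by
  intro x hx y hy a b ha hb hab
  rw [mem_meanSet_iff] at hx hy ⊢
  intro v
  rw [inner_add_right, inner_smul_right, inner_smul_right]
  have h1 := mul_le_mul_of_nonneg_left (hx v) ha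
  have h2 := mul_le_mul_of_nonneg_left (hy v) hb
  have h3 : a * S.E (S.lin X v) + b * S.E (S.lin X v) = S.E (S.lin X v) := by
    rw [← add_mul, hab, one_mul]
  linarith

theorem lipschitz_norm_euclidean : ∃ K : ℝ≥0, LipschitzWith K
    (fun x : EuclideanSpace ℝ (Fin d) => ‖x‖) := ⟨1, lipschitzWith_one_norm⟩

/-- The norm of a random vector, as an element of `H`. -/
noncomputable def normOf (X : Fin d → S.H) : S.H := S.comp X (fun x => ‖x‖) lipschitz_norm_euclidean

theorem normOf_apply (X : Fin d → S.H) (ω : Ω) : (S.normOf X : Ω → ℝ) ω = ‖S.val X ω‖ := rfl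

theorem E_normOf_nonneg (X : Fin d → S.H) : 0 ≤ S.E (S.normOf X) := by
  rw [← S.E_zero]
  exact S.mono _ _ fun ω => norm_nonneg _

theorem norm_le_of_mem_meanSet (X : Fin d → S.H) {y : EuclideanSpace ℝ (Fin d)}
    (hy : y ∈ S.meanSet X) : ‖y‖ ≤ S.E (S.normOf X) := by
  have h1 := (S.mem_meanSet_iff X y).1 hy y
  have h2 : S.E (S.lin X y) ≤ S.E (‖y‖ • S.normOf X) := S.mono _ _ fun ω => by
    rw [lin_apply]
    exact real_inner_le_norm _ _
  rw [S.pos_hom _ _ (norm_nonneg y)] at h2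
  rw [real_inner_self_eq_norm_sq] at h1
  rcases (norm_nonneg y).eq_or_lt with h0 | h0
  · rw [← h0]
    exact S.E_normOf_nonneg X
  · exact le_of_mul_le_mul_left (by nlinarith) h0

theorem isCompact_meanSet (X : Fin d → S.H) : IsCompact (S.meanSet X) := by
  refine Metric.isCompact_of_isClosed_isBounded ?_ ?_
  · have : S.meanSet X = ⋂ v, {x | inner ℝ v x ≤ S.E (S.lin X v)} := by
      ext x
      simp [mem_meanSet_iff]
    rw [this]
    exact isClosed_iInter fun v =>
      isClosed_le (continuous_const.inner continuous_id) continuous_const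
  · exact isBounded_iff_forall_norm_le.2
      ⟨S.E (S.normOf X), fun y hy => S.norm_le_of_mem_meanSet X hy⟩

theorem nonempty_meanSet (X : Fin d → S.H) : (S.meanSet X).Nonempty :=
  let ⟨y, hy, _⟩ := S.exists_mem_meanSet_inner_eq X 0
  ⟨y, hy⟩

theorem E_le_expect {f : Ω → ℝ} (hf : S.HasFiniteExpect f) (Y : S.H)
    (hY : ∀ ω, (Y : Ω → ℝ) ω ≤ f ω) : S.E Y ≤ S.expect f :=
  le_csSup hf ⟨Y, hY, rfl⟩

theorem expect_nonneg {f : Ω → ℝ} (hf : S.HasFiniteExpect f) (h0 : ∀ ω, 0 ≤ f ω) :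
    0 ≤ S.expect f := by
  have := S.E_le_expect hf 0 h0
  rwa [S.E_zero] at this

theorem two_mul_E_normOf_le {X : Fin d → S.H}
    (hX : S.HasFiniteExpect fun ω => ‖S.val X ω‖ ^ 2) (a : ℝ) (ha : 0 ≤ a) :
    2 * a * S.E (S.normOf X) ≤ S.expect (fun ω => ‖S.val X ω‖ ^ 2) + a ^ 2 := by
  let K : S.H := ⟨fun _ => -a ^ 2, S.const_mem _⟩
  have h1 : S.E ((2 * a) • S.normOf X + K) ≤ S.expect fun ω => ‖S.val X ω‖ ^ 2 := by
    refine S.E_le_expect hX _ fun ω => ?_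
    change 2 * a * ‖S.val X ω‖ + -a ^ 2 ≤ ‖S.val X ω‖ ^ 2
    nlinarith [sq_nonneg (‖S.val X ω‖ - a)]
  have h2 := S.E_le_add ((2 * a) • S.normOf X) ((2 * a) • S.normOf X + K) (a ^ 2) fun ω => by
    change 2 * a * ‖S.val X ω‖ ≤ 2 * a * ‖S.val X ω‖ + -a ^ 2 + a ^ 2
    linarith
  rw [S.pos_hom _ _ (by positivity)] at h2
  linarith

theorem norm_sq_le_of_mem_meanSet {X : Fin d → S.H}
    (hX : S.HasFiniteExpect fun ω => ‖S.val X ω‖ ^ 2) {y : EuclideanSpace ℝ (Fin d)}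
    (hy : y ∈ S.meanSet X) : ‖y‖ ^ 2 ≤ S.expect fun ω => ‖S.val X ω‖ ^ 2 := by
  have h1 := S.norm_le_of_mem_meanSet X hy
  have h2 := S.two_mul_E_normOf_le hX _ (S.E_normOf_nonneg X)
  nlinarith [norm_nonneg y]

theorem E_le_of_le_norm_sub_sq {X : Fin d → S.H}
    (hX : S.HasFiniteExpect fun ω => ‖S.val X ω‖ ^ 2) {y : EuclideanSpace ℝ (Fin d)}
    (hy : y ∈ S.meanSet X) {ε : ℝ} (hε : 0 < ε) (Y : S.H)
    (hY : ∀ ω, (Y : Ω → ℝ) ω ≤ ‖S.val X ω - y‖ ^ 2 / (2 * ε)) :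
    S.E Y ≤ 2 * (S.expect fun ω => ‖S.val X ω‖ ^ 2) / ε := by
  let K : S.H := ⟨fun _ => -‖y‖ ^ 2, S.const_mem _⟩
  have h1 : S.E (ε • Y + K) ≤ S.expect fun ω => ‖S.val X ω‖ ^ 2 := by
    refine S.E_le_expect hX _ fun ω => ?_
    change ε * (Y : Ω → ℝ) ω + -‖y‖ ^ 2 ≤ ‖S.val X ω‖ ^ 2
    have h2 := hY ω
    rw [le_div_iff₀ (by positivity)] at h2
    have h3 := parallelogram_law_with_norm ℝ (S.val X ω) y
    nlinarith [sq_nonneg ‖S.val X ω + y‖]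
  have h2 := S.E_le_add (ε • Y) (ε • Y + K) (‖y‖ ^ 2) fun ω => by
    change ε * (Y : Ω → ℝ) ω ≤ ε * (Y : Ω → ℝ) ω + -‖y‖ ^ 2 + ‖y‖ ^ 2
    linarith
  rw [S.pos_hom _ _ hε.le] at h2
  have h3 := S.norm_sq_le_of_mem_meanSet hX hy
  rw [le_div_iff₀ hε]
  linarith

end vectors

end SublinearExpectationSpace

theorem lipschitzWith_sqrt_add_sq {E : Type*} [PseudoMetricSpace E] (ε : ℝ) {f : E → ℝ}
    (hf : LipschitzWith 1 f) : LipschitzWith 1 fun x => Real.sqrt (ε ^ 2 + f x ^ 2) := by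
  refine LipschitzWith.of_le_add fun x y => ?_
  have hd : |f x - f y| ≤ dist x y := by
    have := hf.dist_le_mul x y
    rwa [Real.dist_eq, NNReal.coe_one, one_mul] at this
  refine le_trans ?_ (add_le_add_right hd _)
  have hs : Real.sqrt (ε ^ 2 + f y ^ 2) ^ 2 = ε ^ 2 + f y ^ 2 := Real.sq_sqrt (by positivity)
  have hb : |f y| ≤ Real.sqrt (ε ^ 2 + f y ^ 2) := Real.abs_le_sqrt (by nlinarith [sq_nonneg ε])
  rw [Real.sqrt_le_left (by positivity)]
  have h1 := mul_le_mul_of_nonneg_right hb (abs_nonneg (f x - f y))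
  rw [← abs_mul] at h1
  nlinarith [le_abs_self (f y * (f x - f y)), sq_abs (f x - f y)]

theorem sqrt_add_norm_add_sq_le {E : Type*} [NormedAddCommGroup E] [InnerProductSpace ℝ E]
    {ε : ℝ} (hε : 0 < ε) (v w : E) :
    Real.sqrt (ε ^ 2 + ‖v + w‖ ^ 2) ≤ Real.sqrt (ε ^ 2 + ‖v‖ ^ 2) +
      inner ℝ ((Real.sqrt (ε ^ 2 + ‖v‖ ^ 2))⁻¹ • v) w + ‖w‖ ^ 2 / (2 * ε) := by
  set s := Real.sqrt (ε ^ 2 + ‖v‖ ^ 2) with hs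
  set r := Real.sqrt (ε ^ 2 + ‖v + w‖ ^ 2) with hr
  have hs2 : s ^ 2 = ε ^ 2 + ‖v‖ ^ 2 := Real.sq_sqrt (by positivity)
  have hr2 : r ^ 2 = ε ^ 2 + ‖v + w‖ ^ 2 := Real.sq_sqrt (by positivity)
  have hεs : ε ≤ s := Real.le_sqrt_of_sq_le (by nlinarith [sq_nonneg ‖v‖])
  have hs0 : 0 < s := hε.trans_le hεs
  rw [norm_add_sq_real] at hr2
  have h1 : ‖w‖ ^ 2 / (2 * s) ≤ ‖w‖ ^ 2 / (2 * ε) := by gcongr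
  have h2 : r ≤ s + s⁻¹ * inner ℝ v w + ‖w‖ ^ 2 / (2 * s) := by
    have : s + s⁻¹ * inner ℝ v w + ‖w‖ ^ 2 / (2 * s) =
        (2 * s ^ 2 + 2 * inner ℝ v w + ‖w‖ ^ 2) / (2 * s) := by
      field_simp
    rw [this, le_div_iff₀ (by positivity)]
    nlinarith [sq_nonneg (r - s)]
  rw [real_inner_smul_left]
  linarith

/-- A smoothed distance to the `k`-th dilate of `K`. -/
noncomputable def dilateGauge {E : Type*} [NormedAddCommGroup E] [NormedSpace ℝ E] (ε : ℝ)
    (K : Set E) (k : ℕ) (x : E) : ℝ :=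
  Real.sqrt (ε ^ 2 + Metric.infDist x ((fun y => (k : ℝ) • y) '' K) ^ 2)

section gauge

variable {E : Type*} [NormedAddCommGroup E] [NormedSpace ℝ E]

theorem lipschitzWith_dilateGauge (ε : ℝ) (K : Set E) (k : ℕ) :
    LipschitzWith 1 (dilateGauge ε K k) :=
  lipschitzWith_sqrt_add_sq ε (Metric.lipschitz_infDist_pt _)

theorem infDist_le_dilateGauge (ε : ℝ) (K : Set E) (k : ℕ) (x : E) :
    Metric.infDist x ((fun y => (k : ℝ) • y) '' K) ≤ dilateGauge ε K k x :=
  Real.le_sqrt_of_sq_le (by nlinarith [sq_nonneg ε])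

theorem dilateGauge_zero {ε : ℝ} (hε : 0 ≤ ε) {K : Set E} (hK : K.Nonempty) :
    dilateGauge ε K 0 0 = ε := by
  have : (fun y : E => ((0 : ℕ) : ℝ) • y) '' K = {0} := by
    simp [hK]
  rw [dilateGauge, this, Metric.infDist_singleton, dist_self]
  simpa using Real.sqrt_sq hε

theorem exists_dilateGauge_eq {ε : ℝ} {K : Set E} (hc : IsCompact K) (hne : K.Nonempty)
    (hconv : Convex ℝ K) (k : ℕ) (x : E) :
    ∃ v : E, dilateGauge ε K k x = Real.sqrt (ε ^ 2 + ‖v‖ ^ 2) ∧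
      ∀ y ∈ K, ∀ z, dilateGauge ε K (k + 1) (x + z) ≤ Real.sqrt (ε ^ 2 + ‖v + (z - y)‖ ^ 2) := by
  obtain ⟨_, ⟨q, hq, rfl⟩, hp⟩ :=
    (hc.image (continuous_const_smul (k : ℝ))).exists_infDist_eq_dist (hne.image _) x
  refine ⟨x - (k : ℝ) • q, ?_, fun y hy z => ?_⟩
  · rw [dilateGauge, hp, dist_eq_norm]
  · have hk : (0 : ℝ) < (k : ℝ) + 1 := by positivity
    have hmem : (k : ℝ) • q + y ∈ (fun y => ((k + 1 : ℕ) : ℝ) • y) '' K := by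
      refine ⟨((k : ℝ) / (k + 1)) • q + (1 / ((k : ℝ) + 1)) • y,
        hconv hq hy (by positivity) (by positivity) (by field_simp), ?_⟩
      simp only [smul_add, smul_smul]
      push_cast
      rw [mul_div_cancel₀ _ hk.ne', mul_div_cancel₀ _ hk.ne', one_smul]
    have h1 := Metric.infDist_le_dist_of_mem (x := x + z) hmem
    rw [dist_eq_norm, show x + z - ((k : ℝ) • q + y) = x - (k : ℝ) • q + (z - y) by abel] at h1
    have h0 := Metric.infDist_nonneg (x := x + z) (s := (fun y => ((k + 1 : ℕ) : ℝ) • y) '' K)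
    unfold dilateGauge
    gcongr

end gauge

namespace SublinearExpectationSpace

variable {Ω : Type*} (S : SublinearExpectationSpace Ω) {d : ℕ}

section step

variable {X : Fin d → S.H} (hX : S.HasFiniteExpect fun ω => ‖S.val X ω‖ ^ 2)
  {y : EuclideanSpace ℝ (Fin d)} (hy : y ∈ S.meanSet X) {ε : ℝ} (hε : 0 < ε)
  {g : EuclideanSpace ℝ (Fin d) → ℝ} (hg : ∃ K : ℝ≥0, LipschitzWith K g)
  {s : ℝ} {u : EuclideanSpace ℝ (Fin d)}
  (hgs : ∀ z, g z ≤ s + inner ℝ u (z - y) + ‖z - y‖ ^ 2 / (2 * ε))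

include hX hy hε hg hgs

theorem E_remainder_le :
    S.E (S.comp X g hg - S.lin X u + ⟨fun _ => inner ℝ u y - s, S.const_mem _⟩) ≤
      2 * (S.expect fun ω => ‖S.val X ω‖ ^ 2) / ε := by
  refine S.E_le_of_le_norm_sub_sq hX hy hε _ fun ω => ?_
  change g (S.val X ω) - (S.lin X u : Ω → ℝ) ω + (inner ℝ u y - s) ≤ _
  rw [lin_apply]
  have := hgs (S.val X ω)
  rw [inner_sub_right] at this
  linarith

theorem E_comp_le_of_quadratic (hu : S.E (S.lin X u) = inner ℝ u y) :
    S.E (S.comp X g hg) ≤ s + 2 * (S.expect fun ω => ‖S.val X ω‖ ^ 2) / ε := by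
  have h1 := S.E_remainder_le hX hy hε hg hgs
  have h2 := S.E_le_add_add (S.comp X g hg)
    (S.comp X g hg - S.lin X u + ⟨fun _ => inner ℝ u y - s, S.const_mem _⟩) (S.lin X u)
    (s - inner ℝ u y) fun ω => by
      change g (S.val X ω) ≤ g (S.val X ω) - (S.lin X u : Ω → ℝ) ω + (inner ℝ u y - s) + _ + _
      linarith
  linarith

theorem neg_le_E_comp_neg_of_quadratic (hg' : ∃ K : ℝ≥0, LipschitzWith K fun z => -g z) :
    -s - 2 * (S.expect fun ω => ‖S.val X ω‖ ^ 2) / ε ≤ S.E (S.comp X (fun z => -g z) hg') := by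
  have h1 := S.E_remainder_le hX hy hε hg hgs
  have h2 := S.E_le_add_add (S.lin X (-u))
    (S.comp X g hg - S.lin X u + ⟨fun _ => inner ℝ u y - s, S.const_mem _⟩)
    (S.comp X (fun z => -g z) hg') (s - inner ℝ u y) fun ω => by
      change _ ≤ g (S.val X ω) - (S.lin X u : Ω → ℝ) ω + (inner ℝ u y - s) + -g (S.val X ω) + _
      rw [lin_apply, lin_apply, inner_neg_left]
      linarith
  have h3 := (S.mem_meanSet_iff X y).1 hy (-u)
  rw [inner_neg_left] at h3
  linarith

end step

theorem lip_add_left {E : Type*} [SeminormedAddCommGroup E] {K : ℝ≥0} {g : E → ℝ}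
    (hg : LipschitzWith K g) (x : E) : LipschitzWith K fun z => g (x + z) :=
  LipschitzWith.of_dist_le_mul fun y z => by simpa using hg.dist_le_mul (x + y) (x + z)

theorem lip_neg {E : Type*} [PseudoMetricSpace E] {K : ℝ≥0} {g : E → ℝ}
    (hg : LipschitzWith K g) : LipschitzWith K fun z => -g z :=
  LipschitzWith.of_dist_le_mul fun y z => by
    rw [dist_neg_neg]
    exact hg.dist_le_mul y z

theorem E_dilateGauge_le {X : Fin d → S.H} (hX : S.HasFiniteExpect fun ω => ‖S.val X ω‖ ^ 2)
    {ε : ℝ} (hε : 0 < ε) (k : ℕ) (x : EuclideanSpace ℝ (Fin d)) :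
    S.E (S.comp X (fun z => dilateGauge ε (S.meanSet X) (k + 1) (x + z))
      ⟨1, lip_add_left (lipschitzWith_dilateGauge ε _ _) x⟩) ≤
      dilateGauge ε (S.meanSet X) k x + 2 * (S.expect fun ω => ‖S.val X ω‖ ^ 2) / ε := by
  obtain ⟨v, hv, h⟩ := exists_dilateGauge_eq (ε := ε) (S.isCompact_meanSet X)
    (S.nonempty_meanSet X) (S.convex_meanSet X) k x
  obtain ⟨y, hy, hyv⟩ := S.exists_mem_meanSet_inner_eq X ((Real.sqrt (ε ^ 2 + ‖v‖ ^ 2))⁻¹ • v)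
  rw [hv]
  exact S.E_comp_le_of_quadratic hX hy hε _
    (fun z => (h y hy z).trans (sqrt_add_norm_add_sq_le hε v (z - y))) hyv

theorem neg_dilateGauge_le_E {X : Fin d → S.H}
    (hX : S.HasFiniteExpect fun ω => ‖S.val X ω‖ ^ 2) {y : EuclideanSpace ℝ (Fin d)}
    (hy : y ∈ S.meanSet X) {ε : ℝ} (hε : 0 < ε) (k : ℕ) (x : EuclideanSpace ℝ (Fin d)) :
    -dilateGauge ε {y} k x - 2 * (S.expect fun ω => ‖S.val X ω‖ ^ 2) / ε ≤
      S.E (S.comp X (fun z => -dilateGauge ε {y} (k + 1) (x + z))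
        ⟨1, lip_neg (lip_add_left (lipschitzWith_dilateGauge ε _ _) x)⟩) := by
  obtain ⟨v, hv, h⟩ := exists_dilateGauge_eq (ε := ε) (isCompact_singleton (x := y))
    (Set.singleton_nonempty y) (convex_singleton y) k x
  rw [hv]
  exact S.neg_le_E_comp_neg_of_quadratic hX hy hε
    ⟨1, lip_add_left (lipschitzWith_dilateGauge ε _ _) x⟩
    (fun z => (h y rfl z).trans (sqrt_add_norm_add_sq_le hε v (z - y))) _

theorem avg_singleton {ι : Type*} (X : ι → Fin d → S.H) (a : ι) : S.avg X {a} = X a := by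
  simp [avg]

theorem card_smul_avg {ι : Type*} (X : ι → Fin d → S.H) {Λ : Finset ι} (h : Λ.Nonempty) :
    (Λ.card : ℝ) • S.avg X Λ = ∑ u ∈ Λ, X u := by
  have : (Λ.card : ℝ) ≠ 0 := by exact_mod_cast h.card_ne_zero
  rw [avg, smul_smul, mul_inv_cancel₀ this, one_smul]

theorem lip_smul_fst_add_snd {h : EuclideanSpace ℝ (Fin d) → ℝ} (hh : LipschitzWith 1 h) (k : ℕ) :
    LipschitzWith ((k : ℝ≥0) + 1)
      fun p : WithLp 2 (EuclideanSpace ℝ (Fin d) × EuclideanSpace ℝ (Fin d)) =>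
        h ((k : ℝ) • p.fst + p.snd) := by
  refine LipschitzWith.of_dist_le_mul fun p q => (hh.dist_le_mul _ _).trans ?_
  rw [NNReal.coe_one, one_mul]
  have h1 : dist p.fst q.fst ≤ dist p q := by
    rw [WithLp.prod_dist_eq_of_L2]
    exact Real.le_sqrt_of_sq_le (by nlinarith [sq_nonneg (dist p.snd q.snd)])
  have h2 : dist p.snd q.snd ≤ dist p q := by
    rw [WithLp.prod_dist_eq_of_L2]
    exact Real.le_sqrt_of_sq_le (by nlinarith [sq_nonneg (dist p.fst q.fst)])
  have h3 := dist_add_add_le ((k : ℝ) • p.fst) p.snd ((k : ℝ) • q.fst) q.snd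
  rw [dist_smul₀, Real.norm_of_nonneg (by positivity)] at h3
  have h4 := mul_le_mul_of_nonneg_left h1 (Nat.cast_nonneg (α := ℝ) k)
  push_cast
  linarith

section induction

variable {ι : Type*} [LinearOrder ι] {time : ι → ℝ} {X : ι → Fin d → S.H} {c α : ℝ}

/-- One new observation is replaced by an independent copy, up to the mixing error. -/
theorem abs_E_sum_insert_sub_le (hmono : StrictMono time) (hmix : S.IsMixingWith time X c α)
    (hid : S.IsIdentical X) (hc : 0 ≤ c) (hα : 0 ≤ α) (o : ι) {Λ : Finset ι} (hΛ : Λ.Nonempty)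
    {a : ι} (ha : ∀ u ∈ Λ, u < a) {D : ℝ} (hD : ∀ u ∈ Λ, D ≤ |time u - time a|)
    {h : EuclideanSpace ℝ (Fin d) → ℝ} (hh : LipschitzWith 1 h) :
    ∃ q : EuclideanSpace ℝ (Fin d) → ℝ, ∃ hq : ∃ K : ℝ≥0, LipschitzWith K q,
      (∀ x, q x = S.E (S.comp (X o) (fun z => h (x + z)) ⟨1, lip_add_left hh x⟩)) ∧
      |S.E (S.comp (∑ u ∈ insert a Λ, X u) h ⟨1, hh⟩) - S.E (S.comp (∑ u ∈ Λ, X u) q hq)| ≤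
        c * (Λ.card + 1) * Real.exp (-α * D) := by
  have hane : a ∉ Λ := fun h => lt_irrefl _ (ha a h)
  obtain ⟨b, hb, hbs⟩ := Finset.exists_mem_eq_sup' hΛ time
  have hq : LipschitzWith 1 fun x => S.E (S.comp (X o) (fun z => h (x + z))
      ⟨1, lip_add_left hh x⟩) := by
    refine LipschitzWith.of_le_add fun x x' => S.E_le_add _ _ _ fun ω => ?_
    have := hh.le_add_mul (x + S.val (X o) ω) (x' + S.val (X o) ω)
    rwa [dist_add_right, NNReal.coe_one, one_mul] at this
  refine ⟨_, ⟨1, hq⟩, fun x => rfl, ?_⟩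
  have key := hmix Λ {a} hΛ (Finset.singleton_nonempty a)
    (by rw [Finset.inf'_singleton, hbs]; exact (hmono (ha b hb)).le) _ _
    (lip_smul_fst_add_snd hh Λ.card)
  rw [Finset.inf'_singleton, hbs] at key
  have e1 : S.E (S.comp (∑ u ∈ insert a Λ, X u) h ⟨1, hh⟩) =
      S.E (S.comp₂ (S.avg X Λ) (S.avg X {a}) _ ⟨_, lip_smul_fst_add_snd hh Λ.card⟩) := by
    refine S.E_congr _ _ fun ω => ?_
    change h (S.val _ ω) = h ((Λ.card : ℝ) • S.val (S.avg X Λ) ω + S.val (S.avg X {a}) ω)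
    rw [← val_smul, ← val_add, card_smul_avg S X hΛ, avg_singleton, Finset.sum_insert hane,
      add_comm]
  have e2 : S.E (S.comp (∑ u ∈ Λ, X u) _ ⟨1, hq⟩) =
      S.E (S.comp (S.avg X Λ) (S.frozen (S.avg X {a}) _ ⟨_, lip_smul_fst_add_snd hh Λ.card⟩)
        (S.lip_frozen (S.avg X {a}) _ ⟨_, lip_smul_fst_add_snd hh Λ.card⟩)) := by
    refine S.E_congr _ _ fun ω => ?_
    change S.E (S.comp (X o) (fun z => h (S.val (∑ u ∈ Λ, X u) ω + z)) _) =
      S.E (S.comp (S.avg X {a}) (fun z => h ((Λ.card : ℝ) • S.val (S.avg X Λ) ω + z)) _)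
    rw [hid o a]
    refine S.E_congr _ _ fun ω' => ?_
    change h (S.val _ ω + S.val (X a) ω') = h ((Λ.card : ℝ) • S.val (S.avg X Λ) ω + S.val _ ω')
    rw [← val_smul, card_smul_avg S X hΛ, avg_singleton]
  rw [e1, e2]
  refine key.trans ?_
  push_cast
  refine mul_le_mul_of_nonneg_left (Real.exp_le_exp.2 ?_) (by positivity)
  rw [neg_mul, neg_mul, abs_sub_comm]
  exact neg_le_neg (mul_le_mul_of_nonneg_left (hD b hb) hα)

theorem E_comp_singleton_sum (hid : S.IsIdentical X) (o a : ι)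
    (h : EuclideanSpace ℝ (Fin d) → ℝ) (hh : ∃ K : ℝ≥0, LipschitzWith K h)
    (hh' : ∃ K : ℝ≥0, LipschitzWith K fun z => h (0 + z)) :
    S.E (S.comp (∑ u ∈ insert a ∅, X u) h hh) = S.E (S.comp (X o) (fun z => h (0 + z)) hh') := by
  rw [hid o a]
  refine S.E_congr _ _ fun ω => ?_
  change h (S.val _ ω) = h (0 + S.val (X a) ω)
  simp

variable (hmono : StrictMono time) (hmix : S.IsMixingWith time X c α) (hid : S.IsIdentical X)
  (hc : 0 ≤ c) (hα : 0 ≤ α) (o : ι) {D b : ℝ} {h : ℕ → EuclideanSpace ℝ (Fin d) → ℝ}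
  (hh : ∀ k, LipschitzWith 1 (h k))

include hmono hmix hid hc hα

theorem E_sum_le_of_step
    (hstep : ∀ k x, S.E (S.comp (X o) (fun z => h (k + 1) (x + z)) ⟨1, lip_add_left (hh _) x⟩) ≤
      h k x + b) (Λ : Finset ι)
    (hD : ∀ u ∈ Λ, ∀ v ∈ Λ, u ≠ v → D ≤ |time u - time v|) :
    S.E (S.comp (∑ u ∈ Λ, X u) (h Λ.card) ⟨1, hh _⟩) ≤
      h 0 0 + Λ.card * b + (Λ.card : ℝ) ^ 2 * (c * Real.exp (-α * D)) := by
  induction Λ using Finset.induction_on_max with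
  | empty =>
    refine le_of_eq ((S.E_const (h 0 0) _ fun ω => ?_).trans (by simp))
    change h 0 (S.val _ ω) = _
    simp [val_zero]
  | insert a Λ ha ih =>
    have hane : a ∉ Λ := fun h => lt_irrefl _ (ha a h)
    have ih' := ih fun u hu v hv =>
      hD u (Finset.mem_insert_of_mem hu) v (Finset.mem_insert_of_mem hv)
    have hpos : 0 ≤ c * Real.exp (-α * D) := by positivity
    rcases Λ.eq_empty_or_nonempty with rfl | hΛ
    · have h1 := hstep 0 0
      rw [← S.E_comp_singleton_sum hid o a _ ⟨1, hh _⟩] at h1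
      simp only [Finset.card_insert_of_notMem hane, Finset.card_empty]
      push_cast
      linarith
    · obtain ⟨q, hq, hqe, hle⟩ := S.abs_E_sum_insert_sub_le hmono hmix hid hc hα o hΛ ha
        (fun u hu => hD u (Finset.mem_insert_of_mem hu) a (Finset.mem_insert_self _ _)
          (ha u hu).ne) (hh (Λ.card + 1))
      have h2 : S.E (S.comp (∑ u ∈ Λ, X u) q hq) ≤
          S.E (S.comp (∑ u ∈ Λ, X u) (h Λ.card) ⟨1, hh _⟩) + b :=
        S.E_le_add _ _ _ fun ω => (hqe _).trans_le (hstep _ _)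
      have h3 := (abs_le.1 hle).2
      simp only [Finset.card_insert_of_notMem hane]
      push_cast
      nlinarith [mul_nonneg (Nat.cast_nonneg (α := ℝ) Λ.card) hpos]

theorem le_E_sum_of_step
    (hstep : ∀ k x, h k x - b ≤
      S.E (S.comp (X o) (fun z => h (k + 1) (x + z)) ⟨1, lip_add_left (hh _) x⟩)) (Λ : Finset ι)
    (hD : ∀ u ∈ Λ, ∀ v ∈ Λ, u ≠ v → D ≤ |time u - time v|) :
    h 0 0 - Λ.card * b - (Λ.card : ℝ) ^ 2 * (c * Real.exp (-α * D)) ≤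
      S.E (S.comp (∑ u ∈ Λ, X u) (h Λ.card) ⟨1, hh _⟩) := by
  induction Λ using Finset.induction_on_max with
  | empty =>
    refine le_of_eq (Eq.trans (by simp) (S.E_const (h 0 0) _ fun ω => ?_).symm)
    change h 0 (S.val _ ω) = _
    simp [val_zero]
  | insert a Λ ha ih =>
    have hane : a ∉ Λ := fun h => lt_irrefl _ (ha a h)
    have ih' := ih fun u hu v hv =>
      hD u (Finset.mem_insert_of_mem hu) v (Finset.mem_insert_of_mem hv)
    have hpos : 0 ≤ c * Real.exp (-α * D) := by positivity
    rcases Λ.eq_empty_or_nonempty with rfl | hΛ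
    · have h1 := hstep 0 0
      rw [← S.E_comp_singleton_sum hid o a _ ⟨1, hh _⟩] at h1
      simp only [Finset.card_insert_of_notMem hane, Finset.card_empty]
      push_cast
      linarith
    · obtain ⟨q, hq, hqe, hle⟩ := S.abs_E_sum_insert_sub_le hmono hmix hid hc hα o hΛ ha
        (fun u hu => hD u (Finset.mem_insert_of_mem hu) a (Finset.mem_insert_self _ _)
          (ha u hu).ne) (hh (Λ.card + 1))
      have h2 : S.E (S.comp (∑ u ∈ Λ, X u) (h Λ.card) ⟨1, hh _⟩) ≤
          S.E (S.comp (∑ u ∈ Λ, X u) q hq) + b :=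
        S.E_le_add _ _ _ fun ω => by
          have := hstep Λ.card (S.val (∑ u ∈ Λ, X u) ω)
          rw [← hqe] at this
          exact sub_le_iff_le_add.1 this
      have h3 := (abs_le.1 hle).1
      simp only [Finset.card_insert_of_notMem hane]
      push_cast
      nlinarith [mul_nonneg (Nat.cast_nonneg (α := ℝ) Λ.card) hpos]

end induction

end SublinearExpectationSpace

theorem le_add_mul_dilateGauge {E : Type*} [NormedAddCommGroup E] [NormedSpace ℝ E] {ε : ℝ}
    {K : Set E} (hc : IsCompact K) (hne : K.Nonempty) {φ : E → ℝ} {l : ℝ≥0}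
    (hφ : LipschitzWith l φ) {M : ℝ} (hM : ∀ p ∈ K, φ p ≤ M) {N : ℕ} (hN : N ≠ 0) (s : E) :
    φ ((N : ℝ)⁻¹ • s) ≤ M + l / N * dilateGauge ε K N s := by
  obtain ⟨_, ⟨q, hq, rfl⟩, hp⟩ :=
    (hc.image (continuous_const_smul (N : ℝ))).exists_infDist_eq_dist (hne.image _) s
  have hN0 : (N : ℝ) ≠ 0 := by exact_mod_cast hN
  have h1 := hφ.le_add_mul ((N : ℝ)⁻¹ • s) q
  have h2 : dist ((N : ℝ)⁻¹ • s) q = (N : ℝ)⁻¹ * dist s ((N : ℝ) • q) := by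
    conv_lhs => rw [← one_smul ℝ q, ← inv_mul_cancel₀ hN0, ← smul_smul, dist_smul₀,
      Real.norm_of_nonneg (by positivity)]
  have h3 := infDist_le_dilateGauge ε K N s
  rw [hp] at h3
  have h4 : (l : ℝ) * ((N : ℝ)⁻¹ * dist s ((N : ℝ) • q)) ≤ l / N * dilateGauge ε K N s := by
    rw [← mul_assoc, ← div_eq_mul_inv]
    gcongr
  rw [h2] at h1
  linarith [hM q hq]

namespace SublinearExpectationSpace

variable {Ω : Type*} (S : SublinearExpectationSpace Ω) {d : ℕ}

theorem exists_isGreatest_image_meanSet (X : Fin d → S.H) {φ : EuclideanSpace ℝ (Fin d) → ℝ}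
    (hφ : Continuous φ) : ∃ M, IsGreatest (φ '' S.meanSet X) M :=
  ((S.isCompact_meanSet X).image hφ).exists_isGreatest ((S.nonempty_meanSet X).image φ)

theorem E_normOf_smul (a : ℝ) (Y : Fin d → S.H) :
    S.E (S.normOf (a • Y)) = |a| * S.E (S.normOf Y) := by
  rw [← S.pos_hom _ _ (abs_nonneg a)]
  refine S.E_congr _ _ fun ω => ?_
  change ‖S.val (a • Y) ω‖ = |a| * ‖S.val Y ω‖
  rw [val_smul, norm_smul, Real.norm_eq_abs]

theorem E_normOf_add_le (Y Z : Fin d → S.H) :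
    S.E (S.normOf (Y + Z)) ≤ S.E (S.normOf Y) + S.E (S.normOf Z) :=
  (S.mono _ (S.normOf Y + S.normOf Z) fun ω => norm_add_le (S.val Y ω) (S.val Z ω)).trans
    (S.subadd _ _)

theorem E_normOf_sum_le {ι κ : Type*} {X : ι → Fin d → S.H} (hid : S.IsIdentical X) (o : ι)
    (s : Finset κ) (t : κ → ι) :
    S.E (S.normOf (∑ k ∈ s, X (t k))) ≤ s.card * S.E (S.normOf (X o)) := by
  have h1 : S.E (S.normOf (∑ k ∈ s, X (t k))) ≤ S.E (∑ k ∈ s, S.normOf (X (t k))) := by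
    refine S.mono _ _ fun ω => ?_
    have : ((∑ k ∈ s, S.normOf (X (t k)) : S.H) : Ω → ℝ) ω = ∑ k ∈ s, ‖S.val (X (t k)) ω‖ := by
      simp [normOf_apply]
    rw [this, normOf_apply, val_sum]
    exact norm_sum_le _ _
  refine h1.trans ((S.E_sum_le _ _).trans (le_of_eq ?_))
  rw [Finset.sum_congr rfl fun k _ => show S.E (S.normOf (X (t k))) = S.E (S.normOf (X o)) from
    hid _ _ _ _, Finset.sum_const, nsmul_eq_mul]

section comparison

variable {φ : EuclideanSpace ℝ (Fin d) → ℝ} {l : ℝ≥0} (hφ : LipschitzWith l φ)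

theorem E_comp_sub_le (Y Z : Fin d → S.H) :
    S.E (S.comp Y φ ⟨l, hφ⟩) - S.E (S.comp Z φ ⟨l, hφ⟩) ≤ l * S.E (S.normOf (Y - Z)) := by
  have := S.E_le_add_add (S.comp Y φ ⟨l, hφ⟩) (S.comp Z φ ⟨l, hφ⟩) ((l : ℝ) • S.normOf (Y - Z)) 0
    fun ω => by
      have h := hφ.le_add_mul (S.val Y ω) (S.val Z ω)
      rw [dist_eq_norm] at h
      exact h.trans (add_zero _).ge
  rw [S.pos_hom _ _ l.coe_nonneg] at this
  linarith

theorem abs_E_comp_sub_le (Y Z : Fin d → S.H) :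
    |S.E (S.comp Y φ ⟨l, hφ⟩) - S.E (S.comp Z φ ⟨l, hφ⟩)| ≤ l * S.E (S.normOf (Y - Z)) := by
  have h : S.E (S.normOf (Z - Y)) = S.E (S.normOf (Y - Z)) := S.E_congr _ _ fun ω => by
    exact norm_sub_rev (S.val Z ω) (S.val Y ω)
  have h1 := S.E_comp_sub_le hφ Z Y
  rw [h] at h1
  exact abs_sub_le_iff.2 ⟨S.E_comp_sub_le hφ Y Z, h1⟩

/-- The bound that needs no mixing. -/
theorem abs_E_comp_sub_max_le (X Y : Fin d → S.H) {M : ℝ}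
    (hM : IsGreatest (φ '' S.meanSet X) M) :
    |S.E (S.comp Y φ ⟨l, hφ⟩) - M| ≤ l * (S.E (S.normOf Y) + S.E (S.normOf X)) := by
  obtain ⟨⟨x, hx, rfl⟩, -⟩ := hM
  have hxn := mul_le_mul_of_nonneg_left (S.norm_le_of_mem_meanSet X hx) l.coe_nonneg
  have h1 := S.E_le_add (S.comp Y φ ⟨l, hφ⟩) ((l : ℝ) • S.normOf Y) (φ x + l * ‖x‖) fun ω => by
    have h := hφ.le_add_mul (S.val Y ω) x
    have h' := mul_le_mul_of_nonneg_left (dist_le_norm_add_norm (S.val Y ω) x) l.coe_nonneg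
    change φ (S.val Y ω) ≤ l * ‖S.val Y ω‖ + _
    linarith
  have h2 := S.E_le_add_add 0 (S.comp Y φ ⟨l, hφ⟩) ((l : ℝ) • S.normOf Y) (-φ x + l * ‖x‖)
    fun ω => by
      have h := hφ.le_add_mul x (S.val Y ω)
      have h' := mul_le_mul_of_nonneg_left (dist_le_norm_add_norm x (S.val Y ω)) l.coe_nonneg
      change 0 ≤ φ (S.val Y ω) + l * ‖S.val Y ω‖ + _
      linarith
  rw [S.E_zero] at h2
  rw [S.pos_hom _ _ l.coe_nonneg] at h1 h2
  rw [abs_le]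
  constructor <;> linarith

end comparison

section rate

variable {ι : Type*} {time : ι → ℝ} {X : ι → Fin d → S.H} {c α : ℝ}
  {φ : EuclideanSpace ℝ (Fin d) → ℝ} {l : ℝ≥0}

/-- The rate for averages over a separated set of times. -/
theorem abs_E_separated_avg_sub_le [LinearOrder ι] (hmono : StrictMono time)
    (hmix : S.IsMixingWith time X c α)
    (hid : S.IsIdentical X) (hc : 0 ≤ c) (hα : 0 ≤ α) (o : ι)
    (hX : S.HasFiniteExpect fun ω => ‖S.val (X o) ω‖ ^ 2) (hφ : LipschitzWith l φ) {M : ℝ}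
    (hM : IsGreatest (φ '' S.meanSet (X o)) M) {Λ : Finset ι} (hΛ : Λ.Nonempty) {D : ℝ}
    (hD : ∀ u ∈ Λ, ∀ v ∈ Λ, u ≠ v → D ≤ |time u - time v|) :
    |S.E (S.comp ((Λ.card : ℝ)⁻¹ • ∑ u ∈ Λ, X u) φ ⟨l, hφ⟩) - M| ≤
      l * ((1 + 2 * S.expect fun ω => ‖S.val (X o) ω‖ ^ 2) / Real.sqrt Λ.card +
        c * (Λ.card * Real.exp (-α * D))) := by
  set N := Λ.card with hN
  set m := S.expect fun ω => ‖S.val (X o) ω‖ ^ 2 with hm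
  have hN0 : N ≠ 0 := hΛ.card_ne_zero
  have hNpos : (0 : ℝ) < N := by exact_mod_cast hΛ.card_pos
  have hs : 0 < Real.sqrt N := Real.sqrt_pos.2 hNpos
  obtain ⟨⟨x, hx, rfl⟩, hub⟩ := hM
  have key : (l : ℝ) / N * (Real.sqrt N + N * (2 * m / Real.sqrt N) +
      (N : ℝ) ^ 2 * (c * Real.exp (-α * D))) =
      l * ((1 + 2 * m) / Real.sqrt N + c * (N * Real.exp (-α * D))) := by
    have h1 : (N : ℝ) = Real.sqrt N * Real.sqrt N := (Real.mul_self_sqrt hNpos.le).symm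
    generalize Real.sqrt N = r at *
    rw [h1]
    field_simp
  have hl : (0 : ℝ) ≤ l / N := by positivity
  rw [← key, abs_sub_le_iff]
  constructor
  · have h1 := S.E_sum_le_of_step hmono hmix hid hc hα o
      (h := dilateGauge (Real.sqrt N) (S.meanSet (X o)))
      (fun k => lipschitzWith_dilateGauge _ _ k) (S.E_dilateGauge_le hX hs) Λ hD
    rw [dilateGauge_zero hs.le (S.nonempty_meanSet _)] at h1
    have h2 := S.E_le_add (S.comp ((N : ℝ)⁻¹ • ∑ u ∈ Λ, X u) φ ⟨l, hφ⟩)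
      (((l : ℝ) / N) • S.comp (∑ u ∈ Λ, X u) (dilateGauge (Real.sqrt N) (S.meanSet (X o)) N)
        ⟨1, lipschitzWith_dilateGauge _ _ _⟩) (φ x) fun ω => by
        have := le_add_mul_dilateGauge (ε := Real.sqrt N) (S.isCompact_meanSet (X o))
          (S.nonempty_meanSet _) hφ (fun p hp => hub ⟨p, hp, rfl⟩) hN0 (S.val (∑ u ∈ Λ, X u) ω)
        rw [add_comm] at this
        exact this
    rw [S.pos_hom _ _ hl] at h2
    have h3 := mul_le_mul_of_nonneg_left h1 hl
    linarith
  · have h1 := S.le_E_sum_of_step hmono hmix hid hc hα o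
      (h := fun k z => -dilateGauge (Real.sqrt N) {x} k z)
      (fun k => lip_neg (lipschitzWith_dilateGauge _ _ k)) (S.neg_dilateGauge_le_E hX hx hs) Λ hD
    rw [dilateGauge_zero hs.le (Set.singleton_nonempty x)] at h1
    have h2 := S.E_le_add
      (((l : ℝ) / N) • S.comp (∑ u ∈ Λ, X u) (fun z => -dilateGauge (Real.sqrt N) {x} N z)
        ⟨1, lip_neg (lipschitzWith_dilateGauge _ _ _)⟩)
      (S.comp ((N : ℝ)⁻¹ • ∑ u ∈ Λ, X u) φ ⟨l, hφ⟩) (-φ x) fun ω => by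
        have := le_add_mul_dilateGauge (ε := Real.sqrt N) (isCompact_singleton (x := x))
          (Set.singleton_nonempty x) (lip_neg hφ) (M := -φ x)
          (fun p hp => by rw [Set.mem_singleton_iff.1 hp]) hN0 (S.val (∑ u ∈ Λ, X u) ω)
        change (l : ℝ) / N * (-dilateGauge (Real.sqrt N) {x} N (S.val (∑ u ∈ Λ, X u) ω)) ≤
          φ ((N : ℝ)⁻¹ • S.val (∑ u ∈ Λ, X u) ω) + -φ x
        linarith
    rw [S.pos_hom _ _ hl] at h2
    have h3 := mul_le_mul_of_nonneg_left h1 hl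
    linarith

theorem E_normOf_sampleMean_le (hid : S.IsIdentical X) (o : ι) (t : ℕ → ι) {n : ℕ} (hn : 1 ≤ n) :
    S.E (S.normOf (S.sampleMean X t n)) ≤ S.E (S.normOf (X o)) := by
  have hn0 : (0 : ℝ) < n := by exact_mod_cast hn
  have h := S.E_normOf_sum_le hid o (Finset.Icc 1 n) t
  rw [Nat.card_Icc, Nat.add_sub_cancel] at h
  rw [sampleMean, E_normOf_smul, abs_of_pos (by positivity), inv_mul_le_iff₀ hn0]
  exact h

theorem E_normOf_sampleMean_sub_le (hid : S.IsIdentical X) (o : ι) (t : ℕ → ι) {n : ℕ}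
    {P : Finset ℕ} (hP : P ⊆ Finset.Icc 1 n) (hPn : P.card < n) :
    S.E (S.normOf (S.sampleMean X t n -
      ((Finset.Icc 1 n \ P).card : ℝ)⁻¹ • ∑ k ∈ Finset.Icc 1 n \ P, X (t k))) ≤
      2 * (P.card / n) * S.E (S.normOf (X o)) := by
  have hcard : ((Finset.Icc 1 n \ P).card : ℝ) = n - P.card := by
    rw [Finset.card_sdiff_of_subset hP, Nat.card_Icc, Nat.add_sub_cancel, Nat.cast_sub hPn.le]
  have hG := S.E_normOf_sum_le hid o (Finset.Icc 1 n \ P) t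
  have hPs := S.E_normOf_sum_le hid o P t
  rw [hcard] at hG ⊢
  have hp : (P.card : ℝ) < n := by exact_mod_cast hPn
  have hn0 : (0 : ℝ) < n := (Nat.cast_nonneg _).trans_lt hp
  have hle : (n : ℝ)⁻¹ ≤ ((n : ℝ) - P.card)⁻¹ := by
    apply inv_anti₀ (by linarith)
    linarith [Nat.cast_nonneg (α := ℝ) P.card]
  have e : S.sampleMean X t n - ((n : ℝ) - P.card)⁻¹ • ∑ k ∈ Finset.Icc 1 n \ P, X (t k) =
      (n : ℝ)⁻¹ • ∑ k ∈ P, X (t k) +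
        ((n : ℝ)⁻¹ - ((n : ℝ) - P.card)⁻¹) • ∑ k ∈ Finset.Icc 1 n \ P, X (t k) := by
    rw [sampleMean, ← Finset.sum_sdiff hP]
    module
  rw [e]
  refine (S.E_normOf_add_le _ _).trans ?_
  rw [E_normOf_smul, E_normOf_smul, abs_of_pos (inv_pos.2 hn0), abs_of_nonpos (by linarith)]
  have h1 := mul_le_mul_of_nonneg_left hPs (inv_pos.2 hn0).le
  have h2 := mul_le_mul_of_nonneg_left hG
    (show 0 ≤ -((n : ℝ)⁻¹ - ((n : ℝ) - P.card)⁻¹) by linarith)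
  have h3 : (n : ℝ)⁻¹ * (P.card * S.E (S.normOf (X o))) +
      -((n : ℝ)⁻¹ - ((n : ℝ) - P.card)⁻¹) * (((n : ℝ) - P.card) * S.E (S.normOf (X o))) =
      2 * (P.card / n) * S.E (S.normOf (X o)) := by
    have : (n : ℝ) - P.card ≠ 0 := by linarith
    field_simp
    ring
  linarith

/-- The rate for sample means when the sampling times outside `P` are separated. -/
theorem abs_E_sampleMean_sub_le_of_separated [LinearOrder ι] (hmono : StrictMono time)
    (hmix : S.IsMixingWith time X c α)
    (hid : S.IsIdentical X) (hc : 0 ≤ c) (hα : 0 ≤ α) (o : ι)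
    (hX : S.HasFiniteExpect fun ω => ‖S.val (X o) ω‖ ^ 2) (hφ : LipschitzWith l φ) {M : ℝ}
    (hM : IsGreatest (φ '' S.meanSet (X o)) M) (t : ℕ → ι) {n : ℕ} (hn : 1 ≤ n) {P : Finset ℕ}
    (hP : P ⊆ Finset.Icc 1 n) {D : ℝ} (hD0 : 0 < D)
    (hD : ∀ i ∈ Finset.Icc 1 n \ P, ∀ j ∈ Finset.Icc 1 n \ P, i ≠ j →
      D ≤ |time (t i) - time (t j)|) :
    |S.E (S.comp (S.sampleMean X t n) φ ⟨l, hφ⟩) - M| ≤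
      (1 + S.expect fun ω => ‖S.val (X o) ω‖ ^ 2) * l *
        (3 / Real.sqrt n + 2 * (P.card / n) + c * (n * Real.exp (-α * D))) := by
  set m := S.expect fun ω => ‖S.val (X o) ω‖ ^ 2 with hm
  have hm0 : 0 ≤ m := S.expect_nonneg hX fun ω => by positivity
  have he : 2 * S.E (S.normOf (X o)) ≤ 1 + m := by
    have := S.two_mul_E_normOf_le hX 1 zero_le_one
    linarith
  have he0 := S.E_normOf_nonneg (X o)
  have hn0 : (0 : ℝ) < n := by exact_mod_cast hn
  have hsn : 0 < Real.sqrt n := Real.sqrt_pos.2 hn0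
  have hl0 : (0 : ℝ) ≤ l := l.coe_nonneg
  have hexp := (Real.exp_pos (-α * D)).le
  rcases le_or_gt ((n : ℝ) / 2) P.card with hbig | hsmall
  · have h1 := S.abs_E_comp_sub_max_le hφ (X o) (S.sampleMean X t n) hM
    have h2 := S.E_normOf_sampleMean_le hid o t hn
    have h3 : 1 ≤ 2 * ((P.card : ℝ) / n) := by
      rw [← mul_div_assoc, le_div_iff₀ hn0]
      linarith
    have h4 : 0 ≤ 3 / Real.sqrt n + c * (n * Real.exp (-α * D)) := by positivity
    calc _ ≤ (l : ℝ) * (1 + m) := h1.trans (mul_le_mul_of_nonneg_left (by linarith) hl0)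
      _ = (1 + m) * l * 1 := by ring
      _ ≤ _ := mul_le_mul_of_nonneg_left (by linarith) (by positivity)
  · have hPn : P.card < n := by
      have : (P.card : ℝ) < n := by linarith
      exact_mod_cast this
    have hcard : ((Finset.Icc 1 n \ P).card : ℝ) = n - P.card := by
      rw [Finset.card_sdiff_of_subset hP, Nat.card_Icc, Nat.add_sub_cancel, Nat.cast_sub hPn.le]
    have hinj : Set.InjOn t (Finset.Icc 1 n \ P : Finset ℕ) := by
      intro i hi j hj hij
      by_contra hne
      have := hD i hi j hj hne
      rw [hij, sub_self, abs_zero] at this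
      linarith
    have hne : ((Finset.Icc 1 n \ P).image t).Nonempty := by
      refine Finset.Nonempty.image (Finset.card_pos.1 ?_) t
      have : (0 : ℝ) < (Finset.Icc 1 n \ P).card := by rw [hcard]; linarith
      exact_mod_cast this
    have h1 := S.abs_E_separated_avg_sub_le hmono hmix hid hc hα o hX hφ hM hne (D := D) (by
      simp only [Finset.mem_image]
      rintro _ ⟨i, hi, rfl⟩ _ ⟨j, hj, rfl⟩ hij
      exact hD i hi j hj fun h => hij (h ▸ rfl))
    rw [Finset.card_image_of_injOn hinj, Finset.sum_image hinj] at h1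
    have h2 := (S.abs_E_comp_sub_le hφ _ _).trans
      (mul_le_mul_of_nonneg_left (S.E_normOf_sampleMean_sub_le hid o t hP hPn) hl0)
    rw [hcard] at h1 h2
    have hsq : Real.sqrt n ≤ 3 / 2 * Real.sqrt (n - P.card) := by
      rw [Real.sqrt_le_left (by positivity), mul_pow, Real.sq_sqrt (by linarith)]
      linarith
    have h3 : (1 + 2 * m) / Real.sqrt (n - P.card) ≤ (1 + m) * (3 / Real.sqrt n) := by
      have : 0 < Real.sqrt (n - P.card) := Real.sqrt_pos.2 (by linarith)
      rw [← mul_div_assoc, div_le_div_iff₀ this hsn]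
      nlinarith
    have h4 : c * (((n : ℝ) - P.card) * Real.exp (-α * D)) ≤
        (1 + m) * (c * (n * Real.exp (-α * D))) := by
      have : c * (((n : ℝ) - P.card) * Real.exp (-α * D)) ≤ c * (n * Real.exp (-α * D)) := by
        gcongr
        linarith [Nat.cast_nonneg (α := ℝ) P.card]
      nlinarith [mul_nonneg hm0 (show 0 ≤ c * (n * Real.exp (-α * D)) by positivity)]
    have h5 : 2 * ((P.card : ℝ) / n) * S.E (S.normOf (X o)) ≤ (1 + m) * (2 * (P.card / n)) := by
      have : (0 : ℝ) ≤ P.card / n := by positivity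
      nlinarith
    have h6 := mul_le_mul_of_nonneg_left (add_le_add (add_le_add h3 h4) h5) hl0
    refine (abs_sub_le _ _ _).trans ((add_le_add h2 h1).trans ?_)
    linarith

end rate

end SublinearExpectationSpace

theorem exp_neg_mul_log_rpow_le {A δ : ℝ} (hA : 0 < A) (hδ : 0 < δ) {n : ℕ} (hn : 1 ≤ n) :
    (n : ℝ) * Real.exp (-(A * Real.log n ^ (1 + δ))) ≤
      Real.exp (3 / 2 * (3 / (2 * A)) ^ δ⁻¹) * (n : ℝ) ^ (-(1 / 2) : ℝ) := by
  have hn0 : (0 : ℝ) < n := by exact_mod_cast hn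
  have hL : 0 ≤ Real.log n := Real.log_natCast_nonneg n
  set x := Real.log n with hx
  have h1 : (n : ℝ) = Real.exp x := (Real.exp_log hn0).symm
  rw [Real.rpow_def_of_pos hn0, ← hx, h1, ← Real.exp_add, ← Real.exp_add, Real.exp_le_exp]
  set y := (3 / (2 * A)) ^ δ⁻¹ with hy
  have hy0 : 0 ≤ y := by positivity
  have hyδ : A * y ^ δ = 3 / 2 := by
    rw [hy, ← Real.rpow_mul (by positivity), inv_mul_cancel₀ hδ.ne', Real.rpow_one]
    field_simp
  suffices 3 / 2 * x ≤ 3 / 2 * y + A * x ^ (1 + δ) by linarith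
  have hxp : 0 ≤ x ^ (1 + δ) := by positivity
  rcases le_total x y with hxy | hxy
  · nlinarith
  · rcases hL.eq_or_lt with h0 | h0
    · rw [← h0] at hxy hxp ⊢
      nlinarith
    · rw [Real.rpow_add h0, Real.rpow_one]
      have := Real.rpow_le_rpow hy0 hxy hδ.le
      have h2 : 3 / 2 ≤ A * x ^ δ := by
        rw [← hyδ]
        gcongr
      nlinarith

theorem inv_sqrt_eq_rpow_neg_half (x : ℝ) (hx : 0 ≤ x) : (Real.sqrt x)⁻¹ = x ^ (-(1 / 2) : ℝ) := by
  rw [Real.sqrt_eq_rpow, Real.rpow_neg hx]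

/-- The rate of convergence along admissible sampling times, for a general index set. -/
theorem SublinearExpectationSpace.exists_rate_of_admissible (α γ δ c c₁ c₂ N₀ : ℝ) (hα : 0 < α)
    (hδ : 0 < δ) (hc : 0 < c) (hc₁ : 0 < c₁) (hc₂ : 0 < c₂) :
    ∃ C : ℝ, 0 < C ∧ ∀ {Ω : Type*} (S : SublinearExpectationSpace Ω) {d : ℕ} {ι : Type}
      [LinearOrder ι] {time : ι → ℝ} (_ : StrictMono time) (o : ι) (X : ι → Fin d → S.H)
      (t : ℕ → ι), S.IsMixingWith time X c α → S.IsIdentical X →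
      S.HasFiniteExpect (fun ω => ‖S.val (X o) ω‖ ^ 2) →
      IsAdmissibleWith γ δ c₁ c₂ N₀ (fun k => time (t k)) →
      ∀ (φ : EuclideanSpace ℝ (Fin d) → ℝ) (l : ℝ≥0) (hφ : LipschitzWith l φ),
        ∃ M : ℝ, IsGreatest (φ '' S.meanSet (X o)) M ∧
          ∀ n : ℕ, 1 ≤ n →
            |S.E (S.comp (S.sampleMean X t n) φ ⟨l, hφ⟩) - M| ≤
                C * (1 + S.expect (fun ω => ‖S.val (X o) ω‖ ^ 2)) * l *
                  ((n : ℝ) ^ (-(1 / 2) : ℝ) + (n : ℝ) ^ (-(1 - γ))) ∧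
            (γ ≤ 1 / 2 →
              |S.E (S.comp (S.sampleMean X t n) φ ⟨l, hφ⟩) - M| ≤
                C * (1 + S.expect (fun ω => ‖S.val (X o) ω‖ ^ 2)) * l *
                  (n : ℝ) ^ (-(1 / 2) : ℝ)) := by
  set A := α * c₂ with hA
  have hA0 : 0 < A := by positivity
  set K := Real.exp (3 / 2 * (3 / (2 * A)) ^ δ⁻¹) with hK
  have hK0 : 0 < K := Real.exp_pos _
  set B := Real.sqrt (max N₀ 2) + 3 + 2 * c₁ + c * K with hB
  have hs0 : 0 ≤ Real.sqrt (max N₀ 2) := Real.sqrt_nonneg _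
  have hcK : 0 < c * K := by positivity
  have hB0 : 0 < B := by positivity
  refine ⟨2 * B, by positivity, ?_⟩
  intro Ω S d ι _ time hmono o X t hmix hid hX hadm φ l hφ
  obtain ⟨M, hM⟩ := S.exists_isGreatest_image_meanSet (X o) hφ.continuous
  refine ⟨M, hM, fun n hn => ?_⟩
  set m := S.expect fun ω => ‖S.val (X o) ω‖ ^ 2 with hm
  have hm0 : 0 ≤ m := S.expect_nonneg hX fun ω => by positivity
  have hn0 : (0 : ℝ) < n := by exact_mod_cast hn
  have hn1 : (1 : ℝ) ≤ n := by exact_mod_cast hn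
  have hl0 : (0 : ℝ) ≤ l := l.coe_nonneg
  have hsn : 0 < Real.sqrt n := Real.sqrt_pos.2 hn0
  set a := (n : ℝ) ^ (-(1 / 2) : ℝ) with ha
  set b := (n : ℝ) ^ (-(1 - γ)) with hb
  have ha' : (Real.sqrt n)⁻¹ = a := inv_sqrt_eq_rpow_neg_half _ hn0.le
  have ha0 : 0 < a := Real.rpow_pos_of_pos hn0 _
  have hb0 : 0 < b := Real.rpow_pos_of_pos hn0 _
  have main : |S.E (S.comp (S.sampleMean X t n) φ ⟨l, hφ⟩) - M| ≤
      (1 + m) * l * (B * (a + b)) := by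
    rcases lt_or_ge (n : ℝ) (max N₀ 2) with hlt | hge
    · have h1 := S.abs_E_comp_sub_max_le hφ (X o) (S.sampleMean X t n) hM
      have h2 := S.E_normOf_sampleMean_le hid o t hn
      have h3 := S.two_mul_E_normOf_le hX 1 zero_le_one
      have h4 : 1 ≤ Real.sqrt (max N₀ 2) * a := by
        rw [← ha', ← div_eq_mul_inv, one_le_div hsn]
        exact Real.sqrt_le_sqrt hlt.le
      have h5 : 1 ≤ B * (a + b) := by
        have : 0 ≤ (3 + 2 * c₁ + c * K) * a := by positivity
        have : 0 ≤ B * b := by positivity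
        nlinarith
      calc _ ≤ (l : ℝ) * (1 + m) := h1.trans (mul_le_mul_of_nonneg_left (by linarith) hl0)
        _ = (1 + m) * l * 1 := by ring
        _ ≤ _ := mul_le_mul_of_nonneg_left h5 (by positivity)
    · obtain ⟨P, hP, hPc, hsep⟩ := hadm n ((le_max_left _ _).trans hge)
      have hlog : 0 < Real.log n := Real.log_pos (by linarith [le_max_right N₀ 2])
      have h1 := S.abs_E_sampleMean_sub_le_of_separated hmono hmix hid hc.le hα.le o hX hφ hM t hn
        hP (show 0 < c₂ * Real.log n ^ (1 + δ) by positivity) hsep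
      refine h1.trans (mul_le_mul_of_nonneg_left ?_ (by positivity))
      have h2 := exp_neg_mul_log_rpow_le hA0 hδ hn
      rw [show -(A * Real.log n ^ (1 + δ)) = -α * (c₂ * Real.log n ^ (1 + δ)) by
        rw [hA]; ring] at h2
      have h3 := mul_le_mul_of_nonneg_left h2 hc.le
      have h4 : (P.card : ℝ) / n ≤ c₁ * b := by
        rw [div_le_iff₀ hn0, mul_assoc, hb]
        rw [← Real.rpow_add_one hn0.ne']
        refine hPc.trans (le_of_eq ?_)
        ring_nf
      rw [div_eq_mul_inv, ha']
      have h5 : 0 ≤ Real.sqrt (max N₀ 2) * (a + b) := by positivity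
      have h6 : 0 ≤ (3 + c * K) * b := by positivity
      have h7 : 0 ≤ c₁ * a := by positivity
      rw [hB]
      linarith
  have hml : 0 ≤ (1 + m) * l * B := by positivity
  refine ⟨main.trans ?_, fun hγ => main.trans ?_⟩
  · nlinarith [mul_nonneg hml (add_pos ha0 hb0).le]
  · have hba : b ≤ a := Real.rpow_le_rpow_of_exponent_le hn1 (by linarith)
    nlinarith [mul_le_mul_of_nonneg_left hba hml]

open Polynomial Filter in
theorem Polynomial.exists_mul_sq_le_sub (P : Polynomial ℝ) (hdeg : 2 ≤ P.natDegree)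
    (hlead : 0 < P.leadingCoeff) :
    ∃ c : ℝ, 0 < c ∧ ∃ K : ℝ, ∀ x y : ℝ, K ≤ x → x ≤ y →
      c * (y ^ 2 - x ^ 2) ≤ P.eval y - P.eval x := by
  set c := P.leadingCoeff / 2 with hc
  set R := P - C c * X ^ 2 with hR
  have hcoeff : 0 < R.coeff P.natDegree := by
    rw [hR, coeff_sub, coeff_C_mul, coeff_X_pow]
    change 0 < P.leadingCoeff - _
    split_ifs <;> linarith
  have hRdeg : R.natDegree = P.natDegree := by
    refine le_antisymm ?_ (le_natDegree_of_ne_zero hcoeff.ne')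
    refine (natDegree_sub_le _ _).trans (max_le le_rfl ((natDegree_C_mul_X_pow_le _ _).trans hdeg))
  have hRlead : 0 < R.leadingCoeff := by rw [leadingCoeff, hRdeg]; exact hcoeff
  have hd : 0 < R.derivative.degree := by
    rw [← natDegree_pos_iff_degree_pos, natDegree_derivative]
    omega
  have hdl : 0 ≤ R.derivative.leadingCoeff := by
    rw [leadingCoeff_derivative]
    positivity
  obtain ⟨K, hK⟩ := (tendsto_atTop.1
    (R.derivative.tendsto_atTop_of_leadingCoeff_nonneg hd hdl) 0).exists_forall_of_atTop
  refine ⟨c, by positivity, K, fun x y hx hxy => ?_⟩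
  have hmono : MonotoneOn (fun z => R.eval z) (Set.Ici K) := by
    refine monotoneOn_of_deriv_nonneg (convex_Ici K) R.continuous.continuousOn
      R.differentiable.differentiableOn fun z hz => ?_
    rw [interior_Ici] at hz
    rw [R.deriv]
    exact hK z hz.le
  have := hmono hx (hx.trans hxy) hxy
  simp only [hR, eval_sub, eval_mul, eval_C, eval_pow, eval_X] at this
  linarith

open Filter in
theorem eventually_log_sq_le_mul_sqrt {c : ℝ} (hc : 0 < c) (K : ℝ) :
    ∃ N₀ : ℝ, 0 < N₀ ∧ ∀ x : ℝ, N₀ ≤ x → K ≤ Real.sqrt x ∧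
      Real.log x ^ (1 + 1 : ℝ) + 1 ≤ c * Real.sqrt x := by
  have h1 : Tendsto Real.sqrt atTop atTop := Real.tendsto_sqrt_atTop
  have h2 : ∀ᶠ x in atTop, ‖Real.log x ^ (1 + 1 : ℝ)‖ ≤ c / 2 * ‖x ^ (1 / 2 : ℝ)‖ :=
    (isLittleO_log_rpow_rpow_atTop (1 + 1) (by norm_num : (0 : ℝ) < 1 / 2)).def (by positivity)
  obtain ⟨N, hN⟩ := ((h1.eventually_ge_atTop (max K (2 / c))).and h2).exists_forall_of_atTop
  refine ⟨max N 1, by positivity, fun x hx => ?_⟩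
  obtain ⟨h3, h4⟩ := hN x ((le_max_left _ _).trans hx)
  refine ⟨(le_max_left _ _).trans h3, ?_⟩
  rw [← Real.sqrt_eq_rpow, Real.norm_of_nonneg (Real.sqrt_nonneg x)] at h4
  have h5 := (le_max_right _ _).trans h3
  rw [div_le_iff₀ hc] at h5
  have h6 := (Real.le_norm_self _).trans h4
  generalize Real.log x ^ (1 + 1 : ℝ) = r at h6 ⊢
  nlinarith

/-- Integer parts of the values of a polynomial of degree at least two are admissible times. -/
theorem exists_isAdmissibleWith_polynomial (P : Polynomial ℝ) (hdeg : 2 ≤ P.natDegree)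
    (hlead : 0 < P.leadingCoeff) :
    ∃ N₀ : ℝ, ∀ t : ℕ → ℕ+,
      (∀ k : ℕ, 1 ≤ k → ((t k : ℕ) : ℤ) = max ⌊P.eval (k : ℝ)⌋ 1) →
      IsAdmissibleWith (1 / 2) 1 1 1 N₀ (fun k => ((t k : ℕ) : ℝ)) := by
  obtain ⟨c, hc, K, hK⟩ := P.exists_mul_sq_le_sub hdeg hlead
  have hP : Filter.Tendsto (fun x => P.eval x) Filter.atTop Filter.atTop :=
    P.tendsto_atTop_of_leadingCoeff_nonneg
      (Polynomial.natDegree_pos_iff_degree_pos.1 (by omega)) hlead.le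
  obtain ⟨K', hK'⟩ := (Filter.tendsto_atTop.1 hP 1).exists_forall_of_atTop
  obtain ⟨N₀, hN₀, hbig⟩ := eventually_log_sq_le_mul_sqrt hc (max K K')
  refine ⟨N₀, fun t ht n hn => ⟨Finset.Icc 1 (Nat.sqrt n), ?_, ?_, ?_⟩⟩
  · exact Finset.Icc_subset_Icc_right (Nat.sqrt_le_self n)
  · rw [Nat.card_Icc, Nat.add_sub_cancel, one_mul, ← Real.sqrt_eq_rpow]
    exact Real.nat_sqrt_le_real_sqrt
  · obtain ⟨hKn, hlog⟩ := hbig n hn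
    have hfloor : ∀ i : ℕ, Real.sqrt n < i → (((t i : ℕ) : ℝ) ≤ P.eval (i : ℝ) ∧
        P.eval (i : ℝ) < ((t i : ℕ) : ℝ) + 1) := by
      intro i hi
      have h1 : 1 ≤ i := by
        have : (0 : ℝ) < i := (Real.sqrt_nonneg _).trans_lt hi
        exact_mod_cast this
      have h2 : (1 : ℤ) ≤ ⌊P.eval (i : ℝ)⌋ := by
        rw [Int.le_floor]
        exact_mod_cast hK' i (((le_max_right _ _).trans hKn).trans hi.le)
      have h3 := ht i h1
      rw [max_eq_left h2] at h3
      have h4 : ((t i : ℕ) : ℝ) = (⌊P.eval (i : ℝ)⌋ : ℝ) := by exact_mod_cast h3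
      rw [h4]
      exact ⟨Int.floor_le _, Int.lt_floor_add_one _⟩
    have key : ∀ i j : ℕ, Real.sqrt n < i → i < j →
        1 * Real.log n ^ (1 + 1 : ℝ) ≤ ((t j : ℕ) : ℝ) - ((t i : ℕ) : ℝ) := by
      intro i j hi hij
      have hij' : (i : ℝ) + 1 ≤ j := by exact_mod_cast hij
      have h1 := hfloor i hi
      have h2 := hfloor j (by linarith)
      have h3 := hK i j (((le_max_left _ _).trans hKn).trans hi.le) (by linarith)
      have hi0 := (Real.sqrt_nonneg (n : ℝ)).trans hi.le
      have h4 : c * Real.sqrt n ≤ c * ((j : ℝ) ^ 2 - (i : ℝ) ^ 2) := by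
        refine mul_le_mul_of_nonneg_left ?_ hc.le
        nlinarith
      linarith
    have hmem : ∀ i ∈ Finset.Icc 1 n \ Finset.Icc 1 (Nat.sqrt n), Real.sqrt n < i := by
      intro i hi
      rw [Finset.mem_sdiff, Finset.mem_Icc, Finset.mem_Icc] at hi
      have h1 : n < i * i := Nat.sqrt_lt.1 (by omega)
      rw [Real.sqrt_lt' (by exact_mod_cast hi.1.1), sq]
      exact_mod_cast h1
    intro i hi j hj hij
    rcases lt_or_gt_of_ne hij with h | h
    · rw [abs_sub_comm]
      exact (key i j (hmem i hi) h).trans (le_abs_self _)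
    · exact (key j i (hmem j hj) h).trans (le_abs_self _)

theorem mainTheorem2 :
    -- rate along admissible sampling times, for processes and for sequences
    (∀ α γ δ c c₁ c₂ N₀ : ℝ, 0 < α → 0 < γ → γ < 1 → 0 < δ → 0 < c → 0 < c₁ → 0 < c₂ → 0 < N₀ →
      ∃ C : ℝ, 0 < C ∧
        ∀ (Ω : Type*) (S : SublinearExpectationSpace Ω) (d : ℕ),
          (∀ (X : ℝ≥0 → Fin d → S.H) (t : ℕ → ℝ≥0),
            S.IsMixingWith (fun u : ℝ≥0 => (u : ℝ)) X c α → S.IsIdentical X →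
            S.HasFiniteExpect (fun ω => ‖S.val (X 0) ω‖ ^ 2) →
            IsAdmissibleWith γ δ c₁ c₂ N₀ (fun k => (t k : ℝ)) →
            ∀ (φ : EuclideanSpace ℝ (Fin d) → ℝ) (l : ℝ≥0) (hφ : LipschitzWith l φ),
              ∃ M : ℝ, IsGreatest (φ '' S.meanSet (X 0)) M ∧
                ∀ n : ℕ, 1 ≤ n →
                  |S.E (S.comp (S.sampleMean X t n) φ ⟨l, hφ⟩) - M| ≤
                      C * (1 + S.expect (fun ω => ‖S.val (X 0) ω‖ ^ 2)) * l *
                        ((n : ℝ) ^ (-(1 / 2) : ℝ) + (n : ℝ) ^ (-(1 - γ))) ∧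
                  (γ ≤ 1 / 2 →
                    |S.E (S.comp (S.sampleMean X t n) φ ⟨l, hφ⟩) - M| ≤
                      C * (1 + S.expect (fun ω => ‖S.val (X 0) ω‖ ^ 2)) * l *
                        (n : ℝ) ^ (-(1 / 2) : ℝ))) ∧
          (∀ (X : ℕ → Fin d → S.H) (m : ℕ → ℕ),
            S.IsMixingWith (fun u : ℕ => (u : ℝ)) X c α → S.IsIdentical X →
            S.HasFiniteExpect (fun ω => ‖S.val (X 0) ω‖ ^ 2) →
            IsAdmissibleWith γ δ c₁ c₂ N₀ (fun k => (m k : ℝ)) →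
            ∀ (φ : EuclideanSpace ℝ (Fin d) → ℝ) (l : ℝ≥0) (hφ : LipschitzWith l φ),
              ∃ M : ℝ, IsGreatest (φ '' S.meanSet (X 0)) M ∧
                ∀ n : ℕ, 1 ≤ n →
                  |S.E (S.comp (S.sampleMean X m n) φ ⟨l, hφ⟩) - M| ≤
                      C * (1 + S.expect (fun ω => ‖S.val (X 0) ω‖ ^ 2)) * l *
                        ((n : ℝ) ^ (-(1 / 2) : ℝ) + (n : ℝ) ^ (-(1 - γ))) ∧
                  (γ ≤ 1 / 2 →
                    |S.E (S.comp (S.sampleMean X m n) φ ⟨l, hφ⟩) - M| ≤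
                      C * (1 + S.expect (fun ω => ‖S.val (X 0) ω‖ ^ 2)) * l *
                        (n : ℝ) ^ (-(1 / 2) : ℝ)))) ∧
    -- polynomial sampling times, for a sequence indexed by the positive integers
    (∀ (Ω : Type*) (S : SublinearExpectationSpace Ω) (d : ℕ) (X : ℕ+ → Fin d → S.H) (α c : ℝ),
      0 < α → 0 < c →
      S.IsMixingWith (fun u : ℕ+ => ((u : ℕ) : ℝ)) X c α → S.IsIdentical X →
      S.HasFiniteExpect (fun ω => ‖S.val (X 1) ω‖ ^ 2) →
      ∀ (P : Polynomial ℝ), 2 ≤ P.natDegree → 0 < P.leadingCoeff →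
      ∀ (t : ℕ → ℕ+), (∀ k : ℕ, 1 ≤ k → ((t k : ℕ) : ℤ) = max ⌊P.eval (k : ℝ)⌋ 1) →
      ∃ C : ℝ, 0 < C ∧
        ∀ (φ : EuclideanSpace ℝ (Fin d) → ℝ) (l : ℝ≥0) (hφ : LipschitzWith l φ),
          ∃ M : ℝ, IsGreatest (φ '' S.meanSet (X 1)) M ∧
            ∀ n : ℕ, 1 ≤ n →
              |S.E (S.comp (S.sampleMean X t n) φ ⟨l, hφ⟩) - M| ≤
                C * l * (n : ℝ) ^ (-(1 / 2) : ℝ)) := by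
  refine ⟨fun α γ δ c c₁ c₂ N₀ hα hγ hγ1 hδ hc hc₁ hc₂ hN₀ => ?_,
    fun Ω S d X α c hα hc hmix hid hX P hdeg hlead t ht => ?_⟩
  · obtain ⟨C, hC, h⟩ := SublinearExpectationSpace.exists_rate_of_admissible
      α γ δ c c₁ c₂ N₀ hα hδ hc hc₁ hc₂
    exact ⟨C, hC, fun Ω S d =>
      ⟨fun X t hmix hid hX hadm => h S (fun _ _ huv => NNReal.coe_lt_coe.2 huv) 0 X t hmix hid hX hadm,
        fun X t hmix hid hX hadm => h S Nat.strictMono_cast 0 X t hmix hid hX hadm⟩⟩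
  · obtain ⟨N₀, hN₀⟩ := exists_isAdmissibleWith_polynomial P hdeg hlead
    obtain ⟨C, hC, h⟩ := SublinearExpectationSpace.exists_rate_of_admissible
      α (1 / 2) 1 c 1 1 N₀ hα one_pos hc one_pos one_pos
    have hm := S.expect_nonneg hX fun ω => by positivity
    refine ⟨C * (1 + S.expect fun ω => ‖S.val (X 1) ω‖ ^ 2), by positivity, fun φ l hφ => ?_⟩
    obtain ⟨M, hM, hrate⟩ := h S (time := fun u : ℕ+ => ((u : ℕ) : ℝ))
      (fun u v huv => Nat.cast_lt.2 (PNat.coe_lt_coe u v |>.2 huv)) 1 X t hmix hid hX (hN₀ t ht)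
      φ l hφ
    exact ⟨M, hM, fun n hn => (hrate n hn).2 le_rfl⟩
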